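/- Let $\Omega\subset\mathbb R^2$ be a bounded polygon with Lipschitz boundary (a bounded connected open set whose boundary is a finite union of closed line segments and is locally, in suitable orthonormal coordinates, the graph of a Lipschitz function with $\Omega$ lying strictly on one side of it). Let $k>0$ and $n(x)=n_1(x)+i\,n_2(x)/k$, where $n_1,n_2$ are bounded smooth real-valued functions on $\Omega$ with $n_1>0$ and $n_2\ge 0$. For complex-valued functions put $$a(u,v)=\int_\Omega \nabla u\cdot\overline{\nabla v}\,dx-k^2\int_\Omega n\,u\,\overline v\,dx\quad(u,v\in H^1(\Omega)),\qquad \langle f,h\rangle=\int_{\partial\Omega} f\,\overline h\,ds\quad(f,h\in L^2(\partial\Omega)).$$ Assume that $k^2$ is not a Neumann eigenvalue associated with $n$ on $\Omega$, i.e. there is no nonzero $u\in H^1(\Omega)$ with $\Delta u+k^2nu=0$ in $\Omega$ and $\partial u/\partial\nu=0$ on $\partial\Omega$ in the weak sense, that is, with $a(u,v)=0$ for all $v\in H^1(\Omega)$. Then there is a constant $C>0$, depending only on $\Omega$, $k$ and $n$, such that for every $g\in L^2(\partial\Omega)$ there is a unique $u\in H^1(\Omega)$ satisfying $$a(u,v)=\langle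 g,v|_{\partial\Omega}\rangle\quad\text{for all } v\in H^1(\Omega),$$ where $v|_{\partial\Omega}\in L^2(\partial\Omega)$ denotes the trace of $v$ on $\partial\Omega$, and this $u$ satisfies $$\|u\|_{H^1(\Omega)}\le C\,\|g\|_{L^2(\partial\Omega)}.$$ -/

import Mathlib

open MeasureTheory Filter Topology
open scoped ContDiff ComplexConjugate

noncomputable section

namespace Steklov

/-- The Euclidean plane `ℝ²`. -/
abbrev Plane : Type := EuclideanSpace ℝ (Fin 2)

/-- `Ω` has a Lipschitz boundary: near each boundary point, after a rotation or reflection of the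
coordinate axes, `Ω` is the set of points lying strictly above the graph of a Lipschitz function. -/
def HasLipschitzBoundary (Ω : Set Plane) : Prop :=
  ∀ x ∈ frontier Ω, ∃ (R : Plane ≃ₗᵢ[ℝ] Plane) (γ : ℝ → ℝ) (K : NNReal) (r : ℝ),
    0 < r ∧ LipschitzWith K γ ∧
      ∀ y ∈ Metric.ball x r, (y ∈ Ω ↔ γ (R y 0) < R y 1)

/-- A bounded (open) polygon with Lipschitz boundary: a bounded domain whose boundary is a finite
union of closed line segments and is Lipschitz. -/
structure IsLipschitzPolygon (Ω : Set Plane) : Prop where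
  isOpen : IsOpen Ω
  isConnected : IsConnected Ω
  isBounded : Bornology.IsBounded Ω
  polygonal : ∃ S : Finset (Plane × Plane), frontier Ω = ⋃ e ∈ S, segment ℝ e.1 e.2
  lipschitz : HasLipschitzBoundary Ω

/-- Arc length on `∂Ω`: the one-dimensional Hausdorff measure, for which a segment has measure
equal to its length. -/
def boundaryMeasure (Ω : Set Plane) : Measure Plane :=
  (Measure.hausdorffMeasure 1 : Measure Plane).restrict (frontier Ω)

/-- `L²(Ω)`, complex valued. -/
abbrev L2 (Ω : Set Plane) : Type := Lp ℂ 2 (volume.restrict Ω)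

/-- `L²(Ω)²`, with values in `ℂ²`. -/
abbrev L2Vec (Ω : Set Plane) : Type := Lp (EuclideanSpace ℂ (Fin 2)) 2 (volume.restrict Ω)

/-- `L²(∂Ω)`, complex valued. -/
abbrev L2Bdry (Ω : Set Plane) : Type := Lp ℂ 2 (boundaryMeasure Ω)

/-- The partial derivative `∂φ/∂xᵢ`. -/
def partialDeriv (i : Fin 2) (φ : Plane → ℝ) (x : Plane) : ℝ :=
  fderiv ℝ φ x (EuclideanSpace.single i 1)

/-- `φ ∈ C_c^∞(Ω)`, real valued. -/
structure IsTestFunction (Ω : Set Plane) (φ : Plane → ℝ) : Prop where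
  smooth : ContDiff ℝ ∞ φ
  compact : HasCompactSupport φ
  support : tsupport φ ⊆ Ω

/-- `p` is the weak gradient of `u` in `Ω`: `∫_Ω u ∂ᵢφ = - ∫_Ω pᵢ φ` for all test functions. -/
def IsWeakGradient (Ω : Set Plane) (u : L2 Ω) (p : L2Vec Ω) : Prop :=
  ∀ φ : Plane → ℝ, IsTestFunction Ω φ → ∀ i : Fin 2,
    ∫ x in Ω, partialDeriv i φ x • u x = -∫ x in Ω, φ x • p x i

theorem IsTestFunction.memLp {Ω : Set Plane} {φ : Plane → ℝ} (h : IsTestFunction Ω φ) :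
    MemLp φ 2 (volume.restrict Ω) :=
  (h.smooth.continuous.memLp_of_hasCompactSupport h.compact).restrict Ω

theorem IsTestFunction.memLp_partialDeriv {Ω : Set Plane} {φ : Plane → ℝ}
    (h : IsTestFunction Ω φ) (i : Fin 2) : MemLp (partialDeriv i φ) 2 (volume.restrict Ω) := by
  have hc : Continuous (partialDeriv i φ) :=
    (h.smooth.continuous_fderiv (by simp)).clm_apply continuous_const
  have hs : HasCompactSupport (partialDeriv i φ) := h.compact.fderiv_apply (𝕜 := ℝ) _
  exact (hc.memLp_of_hasCompactSupport hs).restrict Ω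

theorem memLp_coord {Ω : Set Plane} (p : L2Vec Ω) (i : Fin 2) :
    MemLp (fun x => p x i) 2 (volume.restrict Ω) :=
  (Lp.memLp p).continuousLinearMap_comp (EuclideanSpace.proj (𝕜 := ℂ) i)

theorem integrable_smul {Ω : Set Plane} {f : Plane → ℝ} {u : Plane → ℂ}
    (hf : MemLp f 2 (volume.restrict Ω)) (hu : MemLp u 2 (volume.restrict Ω)) :
    Integrable (fun x => f x • u x) (volume.restrict Ω) :=
  memLp_one_iff_integrable.1 (hu.smul hf)

/-- The Sobolev space `H¹(Ω)` of complex-valued functions, as the space of pairs `(u, ∇u)` in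
`L²(Ω) × L²(Ω)²` where `∇u` is the weak gradient of `u`.  The norm inherited from the Hilbert
product is `‖u‖²_{H¹(Ω)} = ‖u‖²_{L²(Ω)} + ‖∇u‖²_{L²(Ω)}`. -/
def H1 (Ω : Set Plane) : Submodule ℂ (WithLp 2 (L2 Ω × L2Vec Ω)) where
  carrier := {w | IsWeakGradient Ω w.fst w.snd}
  zero_mem' := by
    intro φ _ i
    have h1 : ∫ x in Ω, partialDeriv i φ x • (0 : L2 Ω) x = 0 := by
      refine integral_eq_zero_of_ae ?_
      filter_upwards [Lp.coeFn_zero ℂ 2 (volume.restrict Ω)] with x hx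
      rw [hx, Pi.zero_apply, smul_zero]
    have h2 : ∫ x in Ω, φ x • (0 : L2Vec Ω) x i = 0 := by
      refine integral_eq_zero_of_ae ?_
      filter_upwards [Lp.coeFn_zero (EuclideanSpace ℂ (Fin 2)) 2 (volume.restrict Ω)] with x hx
      rw [hx, Pi.zero_apply, PiLp.zero_apply, smul_zero]
      rfl
    rw [WithLp.zero_fst, WithLp.zero_snd, h1, h2, neg_zero]
  add_mem' := by
    intro a b ha hb φ hφ i
    have h1 : ∫ x in Ω, partialDeriv i φ x • (a.fst + b.fst : L2 Ω) x
        = (∫ x in Ω, partialDeriv i φ x • a.fst x) + ∫ x in Ω, partialDeriv i φ x • b.fst x := by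
      rw [← integral_add (integrable_smul (hφ.memLp_partialDeriv i) (Lp.memLp _))
        (integrable_smul (hφ.memLp_partialDeriv i) (Lp.memLp _))]
      refine integral_congr_ae ?_
      filter_upwards [Lp.coeFn_add a.fst b.fst] with x hx
      rw [hx, Pi.add_apply, smul_add]
    have h2 : ∫ x in Ω, φ x • (a.snd + b.snd : L2Vec Ω) x i
        = (∫ x in Ω, φ x • a.snd x i) + ∫ x in Ω, φ x • b.snd x i := by
      rw [← integral_add (integrable_smul hφ.memLp (memLp_coord _ i))
        (integrable_smul hφ.memLp (memLp_coord _ i))]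
      refine integral_congr_ae ?_
      filter_upwards [Lp.coeFn_add a.snd b.snd] with x hx
      rw [hx, Pi.add_apply, PiLp.add_apply, smul_add]
    rw [WithLp.add_fst, WithLp.add_snd, h1, h2, ha φ hφ i, hb φ hφ i, neg_add]
  smul_mem' := by
    intro c a ha φ hφ i
    have h1 : ∫ x in Ω, partialDeriv i φ x • (c • a.fst : L2 Ω) x
        = c • ∫ x in Ω, partialDeriv i φ x • a.fst x := by
      rw [← integral_smul]
      refine integral_congr_ae ?_
      filter_upwards [Lp.coeFn_smul c a.fst] with x hx
      rw [hx, Pi.smul_apply, smul_comm]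
    have h2 : ∫ x in Ω, φ x • (c • a.snd : L2Vec Ω) x i = c • ∫ x in Ω, φ x • a.snd x i := by
      rw [← integral_smul]
      refine integral_congr_ae ?_
      filter_upwards [Lp.coeFn_smul c a.snd] with x hx
      rw [hx, Pi.smul_apply, PiLp.smul_apply, smul_comm]
    rw [WithLp.smul_fst, WithLp.smul_snd, h1, h2, ha φ hφ i, smul_neg]

/-- The underlying `L²` function of an element of `H¹(Ω)`. -/
def H1.toL2 {Ω : Set Plane} (u : H1 Ω) : L2 Ω := (u : WithLp 2 (L2 Ω × L2Vec Ω)).fst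

/-- The weak gradient of an element of `H¹(Ω)`. -/
def H1.grad {Ω : Set Plane} (u : H1 Ω) : L2Vec Ω := (u : WithLp 2 (L2 Ω × L2Vec Ω)).snd

/-- `τ ∈ L²(∂Ω)` is the trace `v|_{∂Ω}` of `v ∈ H¹(Ω)`: there are functions `φₘ`, smooth up to the
boundary, with `φₘ → v` in `H¹(Ω)` and `φₘ|_{∂Ω} → τ` in `L²(∂Ω)`. -/
def IsTrace (Ω : Set Plane) (v : H1 Ω) (τ : L2Bdry Ω) : Prop :=
  ∃ (φ : ℕ → Plane → ℂ) (w : ℕ → H1 Ω) (t : ℕ → L2Bdry Ω),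
    (∀ m, ContDiff ℝ ∞ (φ m)) ∧
    (∀ m, H1.toL2 (w m) =ᵐ[volume.restrict Ω] φ m) ∧
    (∀ m, t m =ᵐ[boundaryMeasure Ω] φ m) ∧
    Tendsto w atTop (𝓝 v) ∧ Tendsto t atTop (𝓝 τ)

/-- `⟨f, g⟩ = ∫_{∂Ω} f ḡ ds`. -/
def bdryPairing {Ω : Set Plane} (f g : L2Bdry Ω) : ℂ :=
  ∫ x, f x * conj (g x) ∂(boundaryMeasure Ω)

/-- The form `(∇u, ∇v) - κ (n u, v)`, where `(f, h) = ∫_Ω f h̄ dx`. -/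
def form {Ω : Set Plane} (κ : ℂ) (n : Plane → ℂ) (u v : H1 Ω) : ℂ :=
  (∫ x in Ω, ∑ i, H1.grad u x i * conj (H1.grad v x i))
    - κ * ∫ x in Ω, n x * H1.toL2 u x * conj (H1.toL2 v x)

/-- `κ` is a Neumann eigenvalue associated with `n` on `Ω`: there is a nontrivial `u ∈ H¹(Ω)` with
`Δu + κ n u = 0` in `Ω`, `∂u/∂ν = 0` on `∂Ω`, in the usual weak (variational) sense. -/
def IsNeumannEigenvalue (Ω : Set Plane) (n : Plane → ℂ) (κ : ℂ) : Prop :=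
  ∃ u : H1 Ω, u ≠ 0 ∧ ∀ v : H1 Ω, form κ n u v = 0

/-- The index of refraction `n = n₁ + i n₂ / k`. -/
def refractiveIndex (k : ℝ) (n₁ n₂ : Plane → ℝ) (x : Plane) : ℂ :=
  (n₁ x : ℂ) + Complex.I * ((n₂ x : ℂ) / (k : ℂ))

/-- `u ∈ H¹(Ω)` solves the source problem `a(u, v) = ⟨g, v⟩` for all `v ∈ H¹(Ω)`, where
`a(u, v) = (∇u, ∇v) - k² (n u, v)`; on the boundary `v` is understood as its trace, and the
existence of that trace is part of the definition. -/
def SolvesSource {Ω : Set Plane} (k : ℝ) (n : Plane → ℂ) (g : L2Bdry Ω) (u : H1 Ω) : Prop :=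
  ∀ v : H1 Ω, (∃ τ, IsTrace Ω v τ) ∧
    ∀ τ, IsTrace Ω v τ → form ((k : ℂ) ^ 2) n u v = bdryPairing g τ

end Steklov

end

/-!
The problem is solved by the Fredholm alternative in the Hilbert space `H¹(Ω)`. Let
`j : H¹(Ω) → L²(Ω)` be the inclusion, `M` the multiplication by `k² n` on `L²(Ω)` and
`T : H¹(Ω) → L²(∂Ω)` the trace operator. Then `a(u, v) = ⟪v, u - K u⟫` with `K = j* (1 + M) j`
(`form_eq_inner`), and `⟨g, T v⟩ = ⟪v, T* g⟫`, so the source problem reads `(1 - K) u = T* g`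
(`solvesSource_iff`). The operator `K` is compact because `j` is, and an eigenvector of `K` for the
eigenvalue `1` would be a Neumann eigenfunction; hence `1 - K` is invertible and the solution
operator is the bounded operator `(1 - K)⁻¹ T*`.

This needs three facts on a bounded Lipschitz domain.

* Boundary estimates (`exists_boundary_estimates`). In a chart in which `Ω` lies above a Lipschitz
  graph, vertical segments of a fixed length starting on the graph lie in `Ω`, and the value of a
  smooth function at a point of such a segment is bounded by its one-dimensional `H¹` norm there.
  Integrating over the graph gives the trace inequality, since arc length on the graph is at most a
  constant times Lebesgue measure on the base; integrating over a strip of width `δ` shows that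
  such a strip carries only `O(δ)` of the squared `L²` norm.
* Density of smooth functions (`denseRange_smoothToH1`). With a partition of unity `χᵢ`, each
  `χᵢ u` is mollified by a kernel whose support is a small ball contained in the downward cone of
  the local graph. At points of `Ω` the mollification then only uses values of `u` in `Ω`, so it
  commutes with the weak gradient. Convergence follows from the continuity of translations in `L²`.
* Rellich's theorem (`isCompactOperator_inclL2`). On a grid of small squares, the Poincaré
  inequality bounds the `L²` norm over the squares inside `Ω` by a small multiple of the `H¹` norm
  and finitely many averages, and the other squares only meet `Ω` in a thin boundary strip. So the
  inclusion is small in norm on a subspace of finite codimension, for every degree of smallness.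

The first fact extends from smooth functions to `H¹(Ω)` by the second one: the trace operator is the
continuous extension of restriction to the boundary, and its values are exactly the traces in the
sense of limits (`isTrace_iff`).
-/

noncomputable section

namespace Steklov

open Set
open scoped ENNReal NNReal InnerProductSpace

/-! ### One-dimensional estimates and coordinates -/

/-- The Cauchy–Schwarz inequality against the constant function `1`. -/
theorem sq_lintegral_le {α : Type*} [MeasurableSpace α] {μ : Measure α} {g : α → ℝ≥0∞}
    (hg : AEMeasurable g μ) : (∫⁻ x, g x ∂μ) ^ 2 ≤ μ univ * ∫⁻ x, g x ^ 2 ∂μ := by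
  have h := ENNReal.lintegral_mul_le_Lp_mul_Lq μ Real.HolderConjugate.two_two
    (aemeasurable_const (b := (1 : ℝ≥0∞))) hg
  simp only [Pi.mul_apply, one_mul, ENNReal.rpow_ofNat] at h
  refine (pow_le_pow_left' h 2).trans_eq ?_
  rw [mul_pow, ← ENNReal.rpow_mul_natCast, ← ENNReal.rpow_mul_natCast]
  norm_num

/-- The oscillation of a `C¹` function on an interval, by the fundamental theorem of calculus and
the Cauchy–Schwarz inequality. -/
theorem enorm_sub_sq_le {a b : ℝ} {f : ℝ → ℂ} (hf : ContDiff ℝ 1 f) {t t' : ℝ}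
    (ht : t ∈ Icc a b) (ht' : t' ∈ Icc a b) :
    ‖f t - f t'‖ₑ ^ 2 ≤ ENNReal.ofReal (b - a) * ∫⁻ s in Ioc a b, ‖deriv f s‖ₑ ^ 2 := by
  have hc : Continuous (deriv f) := hf.continuous_deriv le_rfl
  have h1 : f t - f t' = ∫ s in t'..t, deriv f s :=
    (intervalIntegral.integral_deriv_eq_sub (fun x _ => hf.differentiable one_ne_zero x)
      (hc.intervalIntegrable _ _)).symm
  have h2 : ‖f t - f t'‖ₑ ≤ ∫⁻ s in Ioc a b, ‖deriv f s‖ₑ := by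
    have h3 : ‖f t - f t'‖ₑ = ‖∫ s in uIoc t' t, deriv f s‖ₑ := by
      rw [h1, ← enorm_norm, intervalIntegral.norm_intervalIntegral_eq, enorm_norm]
    rw [h3]
    refine (enorm_integral_le_lintegral_enorm _).trans (lintegral_mono_set ?_)
    exact fun s hs => ⟨(le_min ht'.1 ht.1).trans_lt hs.1, hs.2.trans (max_le ht'.2 ht.2)⟩
  refine (pow_le_pow_left' h2 2).trans ((sq_lintegral_le hc.enorm.measurable.aemeasurable).trans ?_)
  rw [Measure.restrict_apply_univ, Real.volume_Ioc]

theorem enorm_sq_le_add {E : Type*} [SeminormedAddCommGroup E] (x y : E) :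
    ‖x‖ₑ ^ 2 ≤ 2 * ‖x - y‖ₑ ^ 2 + 2 * ‖y‖ₑ ^ 2 := by
  have h : ‖x‖₊ ^ 2 ≤ 2 * ‖x - y‖₊ ^ 2 + 2 * ‖y‖₊ ^ 2 := by
    have h1 : ‖x‖ ≤ ‖x - y‖ + ‖y‖ := by simpa using norm_add_le (x - y) y
    have : ‖x‖ ^ 2 ≤ 2 * ‖x - y‖ ^ 2 + 2 * ‖y‖ ^ 2 := by
      nlinarith [norm_nonneg x, norm_nonneg (x - y), norm_nonneg y, sq_nonneg (‖x - y‖ - ‖y‖)]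
    exact_mod_cast this
  simp only [enorm]
  exact_mod_cast h

/-- A point value of a `C¹` function on an interval of length `ℓ` is controlled by the `H¹` norm. -/
theorem ofReal_mul_enorm_sq_le {a ℓ : ℝ} {f : ℝ → ℂ} (hf : ContDiff ℝ 1 f) {t : ℝ}
    (ht : t ∈ Icc a (a + ℓ)) :
    ENNReal.ofReal ℓ * ‖f t‖ₑ ^ 2 ≤ 2 * (∫⁻ s in Ioc a (a + ℓ), ‖f s‖ₑ ^ 2) +
      2 * ENNReal.ofReal ℓ ^ 2 * ∫⁻ s in Ioc a (a + ℓ), ‖deriv f s‖ₑ ^ 2 := by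
  set D := ∫⁻ s in Ioc a (a + ℓ), ‖deriv f s‖ₑ ^ 2
  have h1 : ∀ s ∈ Ioc a (a + ℓ), ‖f t‖ₑ ^ 2 ≤ 2 * (ENNReal.ofReal ℓ * D) + 2 * ‖f s‖ₑ ^ 2 := by
    intro s hs
    refine (enorm_sq_le_add (f t) (f s)).trans ?_
    gcongr
    simpa [D] using enorm_sub_sq_le hf ht (Ioc_subset_Icc_self hs)
  have h2 := setLIntegral_mono' measurableSet_Ioc h1 (μ := volume)
  rw [lintegral_add_left (by fun_prop), setLIntegral_const, setLIntegral_const, Real.volume_Ioc,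
    lintegral_const_mul _ (by have := hf.continuous; fun_prop)] at h2
  simp only [add_sub_cancel_left] at h2
  calc _ = ‖f t‖ₑ ^ 2 * ENNReal.ofReal ℓ := mul_comm _ _
    _ ≤ _ := h2
    _ = _ := by ring

/-- The density `|φ|² + |∇φ|²` of the squared `H¹` norm. -/
def energyDensity (φ : Plane → ℂ) (x : Plane) : ℝ≥0∞ := ‖φ x‖ₑ ^ 2 + ‖fderiv ℝ φ x‖ₑ ^ 2

theorem measurable_energyDensity {φ : Plane → ℂ} (hφ : ContDiff ℝ ∞ φ) :
    Measurable (energyDensity φ) := by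
  have h1 := hφ.continuous
  have h2 : Continuous (fderiv ℝ φ) := hφ.continuous_fderiv (by simp)
  unfold energyDensity
  fun_prop

theorem contDiff_line {φ : Plane → ℂ} (hφ : ContDiff ℝ ∞ φ) (x v : Plane) :
    ContDiff ℝ 1 (fun t : ℝ => φ (x + t • v)) :=
  (hφ.of_le (by exact_mod_cast le_top)).comp (by fun_prop)

theorem enorm_deriv_line_le {φ : Plane → ℂ} (hφ : ContDiff ℝ ∞ φ) (x : Plane) {v : Plane}
    (hv : ‖v‖ ≤ 1) (t : ℝ) :
    ‖deriv (fun t : ℝ => φ (x + t • v)) t‖ₑ ≤ ‖fderiv ℝ φ (x + t • v)‖ₑ := by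
  have h1 : HasDerivAt (fun t : ℝ => x + t • v) v t := by
    simpa using ((hasDerivAt_id t).smul_const v).const_add x
  have h2 : HasFDerivAt φ (fderiv ℝ φ (x + t • v)) (x + t • v) :=
    (hφ.differentiable (by simp) _).hasFDerivAt
  have h3 : deriv (fun t : ℝ => φ (x + t • v)) t = fderiv ℝ φ (x + t • v) v :=
    (h2.comp_hasDerivAt t h1).deriv
  rw [h3, enorm_le_iff_norm_le]
  exact ((fderiv ℝ φ _).le_opNorm v).trans (mul_le_of_le_one_right (norm_nonneg _) hv)

/-- The orthonormal coordinates given by `R`, as a map from `ℝ × ℝ` to the plane. -/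
def chart (R : Plane ≃ₗᵢ[ℝ] Plane) (p : ℝ × ℝ) : Plane := R.symm !₂[p.1, p.2]

theorem apply_chart_zero (R : Plane ≃ₗᵢ[ℝ] Plane) (p : ℝ × ℝ) : R (chart R p) 0 = p.1 := by
  simp [chart]

theorem apply_chart_one (R : Plane ≃ₗᵢ[ℝ] Plane) (p : ℝ × ℝ) : R (chart R p) 1 = p.2 := by
  simp [chart]

theorem chart_apply (R : Plane ≃ₗᵢ[ℝ] Plane) (x : Plane) : chart R (R x 0, R x 1) = x := by
  rw [chart, LinearIsometryEquiv.symm_apply_eq]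
  ext i; fin_cases i <;> rfl

theorem chart_eq (R : Plane ≃ₗᵢ[ℝ] Plane) (s t : ℝ) :
    chart R (s, t) = chart R (s, 0) + t • chart R (0, 1) := by
  simp only [chart, ← map_smul, ← map_add]
  congr 1
  ext i; fin_cases i <;> simp

theorem norm_chart (R : Plane ≃ₗᵢ[ℝ] Plane) (p : ℝ × ℝ) :
    ‖chart R p‖ = √(p.1 ^ 2 + p.2 ^ 2) := by
  rw [chart, LinearIsometryEquiv.norm_map, EuclideanSpace.norm_eq]
  simp

theorem norm_chart_le (R : Plane ≃ₗᵢ[ℝ] Plane) (p : ℝ × ℝ) : ‖chart R p‖ ≤ |p.1| + |p.2| := by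
  rw [norm_chart]
  refine Real.sqrt_le_iff.2 ⟨by positivity, ?_⟩
  nlinarith [sq_abs p.1, sq_abs p.2, abs_nonneg p.1, abs_nonneg p.2]

theorem chart_sub (R : Plane ≃ₗᵢ[ℝ] Plane) (p q : ℝ × ℝ) :
    chart R p - chart R q = chart R (p - q) := by
  simp only [chart, ← map_sub]
  congr 1
  ext i; fin_cases i <;> simp

theorem measurePreserving_chart (R : Plane ≃ₗᵢ[ℝ] Plane) : MeasurePreserving (chart R) := by
  have h1 := (volume_preserving_finTwoArrow ℝ).symm
  have h2 := PiLp.volume_preserving_toLp (Fin 2)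
  have h3 := R.symm.measurePreserving
  have h4 : chart R = R.symm ∘ WithLp.toLp 2 ∘ (MeasurableEquiv.finTwoArrow (α := ℝ)).symm := rfl
  rw [h4]
  exact h3.comp (h2.comp h1)

theorem continuous_chart (R : Plane ≃ₗᵢ[ℝ] Plane) : Continuous (chart R) := by
  unfold chart
  fun_prop

/-- Tonelli's theorem in rotated coordinates. -/
theorem setLIntegral_chart (R : Plane ≃ₗᵢ[ℝ] Plane) {g : Plane → ℝ≥0∞} (hg : Measurable g)
    {A : Set Plane} (hA : MeasurableSet A) :
    ∫⁻ x in A, g x = ∫⁻ s, ∫⁻ t in {t | chart R (s, t) ∈ A}, g (chart R (s, t)) := by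
  rw [← (measurePreserving_chart R).setLIntegral_comp_preimage hA hg,
    ← lintegral_indicator ((continuous_chart R).measurable hA), Measure.volume_eq_prod,
    lintegral_prod (μ := volume) (ν := volume)
      (fun p => (chart R ⁻¹' A).indicator (fun a => g (chart R a)) p)
      ((hg.comp (continuous_chart R).measurable).indicator
      ((continuous_chart R).measurable hA)).aemeasurable]
  refine lintegral_congr fun s => ?_
  rw [← lintegral_indicator]
  · rfl
  · exact ((continuous_chart R).comp (by fun_prop : Continuous fun t : ℝ => (s, t))).measurable hA

/-! ### Estimates near a Lipschitz boundary -/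

/-- Along a vertical segment in a chart, a point value of a smooth function is controlled by the
energy on that segment. -/
theorem ofReal_mul_enorm_sq_chart_le (R : Plane ≃ₗᵢ[ℝ] Plane) {φ : Plane → ℂ}
    (hφ : ContDiff ℝ ∞ φ) {a ℓ t : ℝ} (s : ℝ) (ht : t ∈ Icc a (a + ℓ)) :
    ENNReal.ofReal ℓ * ‖φ (chart R (s, t))‖ₑ ^ 2 ≤
      (2 + 2 * ENNReal.ofReal ℓ ^ 2) *
        ∫⁻ t in Ioc a (a + ℓ), energyDensity φ (chart R (s, t)) := by
  have hv : ‖chart R (0, 1)‖ ≤ 1 := by simpa using norm_chart_le R (0, 1)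
  have h := ofReal_mul_enorm_sq_le (contDiff_line hφ (chart R (s, 0)) (chart R (0, 1))) ht
  simp only [← chart_eq] at h
  refine h.trans ?_
  rw [add_mul]
  gcongr with t t
  · exact le_self_add
  · have := enorm_deriv_line_le hφ (chart R (s, 0)) hv t
    simp only [← chart_eq] at this
    exact (pow_le_pow_left' this 2).trans le_add_self

theorem lipschitzWith_graph (R : Plane ≃ₗᵢ[ℝ] Plane) {γ : ℝ → ℝ} {K : ℝ≥0}
    (hγ : LipschitzWith K γ) : LipschitzWith (1 + K) (fun s => chart R (s, γ s)) := by
  refine LipschitzWith.of_dist_le_mul fun s s' => ?_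
  have := hγ.dist_le_mul s s'
  rw [Real.dist_eq, Real.dist_eq] at this
  rw [dist_eq_norm, chart_sub, Real.dist_eq]
  refine (norm_chart_le R _).trans ?_
  simp only [Prod.fst_sub, Prod.snd_sub, NNReal.coe_add, NNReal.coe_one]
  linarith

/-- The length measure on a Lipschitz graph is dominated by Lebesgue measure on the base. -/
theorem hausdorffMeasure_restrict_graph_le (R : Plane ≃ₗᵢ[ℝ] Plane) {γ : ℝ → ℝ} {K : ℝ≥0}
    (hγ : LipschitzWith K γ) {I : Set ℝ} {S : Set Plane}
    (hS : S ⊆ (fun s => chart R (s, γ s)) '' I) :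
    (Measure.hausdorffMeasure 1 : Measure Plane).restrict S ≤
      ((1 + K : ℝ≥0) : ℝ≥0∞) • (volume.restrict I).map (fun s => chart R (s, γ s)) := by
  have hG := lipschitzWith_graph R hγ
  refine Measure.le_iff.2 fun A hA => ?_
  rw [Measure.restrict_apply hA, Measure.smul_apply,
    Measure.map_apply hG.continuous.measurable hA,
    Measure.restrict_apply (hG.continuous.measurable hA), smul_eq_mul, ← hausdorffMeasure_real]
  refine (measure_mono ?_).trans
    ((hG.hausdorffMeasure_image_le zero_le_one _).trans_eq (by rw [ENNReal.rpow_one]))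
  rintro x ⟨hxA, hxS⟩
  obtain ⟨s, hs, rfl⟩ := hS hxS
  exact ⟨s, ⟨hxA, hs⟩, rfl⟩

/-- Near a boundary point of a Lipschitz domain, the boundary values and the values in a thin
boundary strip are controlled by the energy: along vertical segments of fixed length inside the
domain, point values are bounded by the one-dimensional energy. -/
theorem exists_local_boundary_estimates {Ω : Set Plane} (ho : IsOpen Ω)
    (hL : HasLipschitzBoundary Ω) {x₀ : Plane} (hx₀ : x₀ ∈ frontier Ω) :
    ∃ ρ > 0, ∃ δ₀ > 0, ∃ C : ℝ≥0∞, C ≠ ⊤ ∧ ∀ φ : Plane → ℂ, ContDiff ℝ ∞ φ →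
      (∫⁻ x in frontier Ω ∩ Metric.ball x₀ ρ, ‖φ x‖ₑ ^ 2 ∂(Measure.hausdorffMeasure 1)
        ≤ C * ∫⁻ x in Ω, energyDensity φ x) ∧
      ∀ δ : ℝ, 0 < δ → δ ≤ δ₀ →
        ∫⁻ x in Ω ∩ Metric.ball x₀ ρ ∩ Metric.thickening δ Ωᶜ, ‖φ x‖ₑ ^ 2
          ≤ C * ENNReal.ofReal δ * ∫⁻ x in Ω, energyDensity φ x := by
  obtain ⟨R, γ, K, r, hr, hγ, hΩ⟩ := hL x₀ hx₀
  have hK : (0 : ℝ) ≤ K := K.2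
  have hγc := hγ.continuous
  have hlip : ∀ s s', |γ s - γ s'| ≤ K * |s - s'| := fun s s' => by
    simpa [Real.dist_eq] using hγ.dist_le_mul s s'
  have hRd : ∀ (x y : Plane) (i : Fin 2), |R x i - R y i| ≤ dist x y := fun x y i => by
    have := PiLp.norm_apply_le (R x - R y) i
    rwa [← map_sub, R.norm_map, ← dist_eq_norm, map_sub, PiLp.sub_apply, Real.norm_eq_abs] at this
  have hRc : ∀ i : Fin 2, Continuous fun y => R y i := fun i =>
    (EuclideanSpace.proj (𝕜 := ℝ) i).continuous.comp R.continuous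
  -- frontier points in the ball lie on the graph
  have hfr : ∀ y ∈ frontier Ω, y ∈ Metric.ball x₀ r → R y 1 = γ (R y 0) := by
    intro y hy hyb
    refine le_antisymm (not_lt.1 fun h => ?_) ?_
    · exact (ho.frontier_eq ▸ hy).2 ((hΩ y hyb).2 h)
    · by_contra! h
      have h1 : ∀ᶠ z in 𝓝 y, R z 1 < γ (R z 0) ∧ z ∈ Metric.ball x₀ r :=
        (((hRc 1).tendsto y).eventually_lt ((hγc.comp (hRc 0)).tendsto y) h).and
          (Metric.isOpen_ball.mem_nhds hyb)
      obtain ⟨z, hz, hzΩ⟩ := (mem_closure_iff_frequently.1 hy.1).and_eventually h1 |>.exists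
      exact absurd ((hΩ z hzΩ.2).1 hz) (not_lt.2 hzΩ.1.le)
  -- vertical segments of length `ℓ` from the graph over `|s - R x₀ 0| < ρ` stay in the ball of
  -- radius `r`: there the graph deviates vertically by at most `K * ρ`, and `ρ + K * ρ = ℓ`
  set ℓ : ℝ := r / 4 with hℓ
  set ρ : ℝ := r / (4 * (1 + K)) with hρ
  have hρ0 : 0 < ρ := by positivity
  have hℓ0 : 0 < ℓ := by positivity
  have hρℓ : ρ + K * ρ = ℓ := by rw [hρ, hℓ]; field_simp
  have hKρ : 0 ≤ K * ρ := by positivity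
  have hx₀1 : R x₀ 1 = γ (R x₀ 0) := hfr x₀ hx₀ (Metric.mem_ball_self hr)
  set I : Set ℝ := Metric.ball (R x₀ 0) ρ with hI
  have hIm : MeasurableSet I := measurableSet_ball
  have hIlip : ∀ s ∈ I, |γ s - R x₀ 1| ≤ K * ρ := by
    intro s hs
    rw [hI, Metric.mem_ball, Real.dist_eq] at hs
    rw [hx₀1]
    exact (hlip _ _).trans (mul_le_mul_of_nonneg_left hs.le hK)
  have hmemI : ∀ x ∈ Metric.ball x₀ ρ, R x 0 ∈ I := fun x hx =>
    (hRd x x₀ 0).trans_lt hx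
  -- the vertical segments of length `ℓ` above the graph lie in the domain
  have hseg : ∀ s ∈ I, ∀ t ∈ Ioc (γ s) (γ s + ℓ), chart R (s, t) ∈ Ω := by
    intro s hs t ht
    have hb : chart R (s, t) ∈ Metric.ball x₀ r := by
      rw [Metric.mem_ball, dist_eq_norm, ← chart_apply R x₀, chart_sub]
      refine (norm_chart_le R _).trans_lt ?_
      have h1 := hIlip s hs
      rw [hI, Metric.mem_ball, Real.dist_eq] at hs
      have h2 : |t - R x₀ 1| ≤ K * ρ + ℓ := by
        rw [abs_le] at h1 ⊢
        constructor <;> linarith [ht.1, ht.2]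
      have : r = 4 * ℓ := by rw [hℓ]; ring
      simp only [Prod.fst_sub, Prod.snd_sub]
      linarith
    rw [hΩ _ hb, apply_chart_zero, apply_chart_one]
    exact ht.1
  set c : ℝ≥0∞ := (ENNReal.ofReal ℓ)⁻¹ * (2 + 2 * ENNReal.ofReal ℓ ^ 2) with hc
  have hc_top : c ≠ ⊤ := by
    refine ENNReal.mul_ne_top (ENNReal.inv_ne_top.2 (by simpa using hℓ0)) ?_
    finiteness
  refine ⟨ρ, hρ0, min (r / 2) (ℓ / (1 + K)), by positivity, ((1 + K : ℝ≥0) : ℝ≥0∞) * c,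
    by finiteness, fun φ hφ => ?_⟩
  set F : ℝ → ℝ≥0∞ := fun s => ∫⁻ t in Ioc (γ s) (γ s + ℓ), energyDensity φ (chart R (s, t))
  have hpt : ∀ s, ∀ t ∈ Icc (γ s) (γ s + ℓ), ‖φ (chart R (s, t))‖ₑ ^ 2 ≤ c * F s := by
    intro s t ht
    have h := ofReal_mul_enorm_sq_chart_le R hφ s ht
    rwa [hc, mul_assoc, mul_comm, ← div_eq_mul_inv, ENNReal.le_div_iff_mul_le
      (Or.inl (by simpa using hℓ0)) (Or.inl ENNReal.ofReal_ne_top), mul_comm]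
  have hF : ∫⁻ s in I, F s ≤ ∫⁻ x in Ω, energyDensity φ x := by
    rw [setLIntegral_chart R (measurable_energyDensity hφ) ho.measurableSet]
    refine (setLIntegral_mono' hIm fun s hs => ?_).trans (setLIntegral_le_lintegral _ _)
    exact lintegral_mono_set fun t ht => hseg s hs t ht
  have hφm : Measurable fun x => ‖φ x‖ₑ ^ 2 := by
    have := hφ.continuous
    fun_prop
  constructor
  · have hsub : frontier Ω ∩ Metric.ball x₀ ρ ⊆ (fun s => chart R (s, γ s)) '' I := by
      rintro x ⟨hx, hxb⟩
      refine ⟨R x 0, hmemI x hxb, ?_⟩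
      have : ρ ≤ r := by linarith
      simp only
      rw [← hfr x hx (Metric.ball_subset_ball this hxb), chart_apply]
    refine (lintegral_mono' (hausdorffMeasure_restrict_graph_le R hγ hsub) le_rfl).trans ?_
    rw [lintegral_smul_measure, lintegral_map hφm (lipschitzWith_graph R hγ).continuous.measurable,
      smul_eq_mul, mul_assoc]
    gcongr
    refine (lintegral_mono fun s => hpt s (γ s) ⟨le_rfl, by linarith⟩).trans ?_
    rw [lintegral_const_mul' _ _ hc_top]
    gcongr
  · intro δ hδ hδ₀
    have hδ1 : δ ≤ r / 2 := hδ₀.trans (min_le_left _ _)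
    have hδ2 : (1 + K) * δ ≤ ℓ := by
      have := hδ₀.trans (min_le_right _ _)
      rw [le_div_iff₀ (by positivity)] at this
      linarith
    rw [setLIntegral_chart R hφm ((ho.measurableSet.inter measurableSet_ball).inter
      Metric.isOpen_thickening.measurableSet)]
    have hpt2 : ∀ s, ∫⁻ t in {t | chart R (s, t) ∈
        Ω ∩ Metric.ball x₀ ρ ∩ Metric.thickening δ Ωᶜ}, ‖φ (chart R (s, t))‖ₑ ^ 2 ≤
        I.indicator (fun s => ((1 + K : ℝ≥0) : ℝ≥0∞) * c * ENNReal.ofReal δ * F s) s := by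
      intro s
      by_cases hs : s ∈ I
      · rw [indicator_of_mem hs]
        have hsub : {t | chart R (s, t) ∈ Ω ∩ Metric.ball x₀ ρ ∩ Metric.thickening δ Ωᶜ} ⊆
            Ioc (γ s) (γ s + (1 + K) * δ) := by
          rintro t ⟨⟨htΩ, htb⟩, htδ⟩
          have : ρ ≤ r / 2 := by linarith
          rw [Metric.mem_ball] at htb
          have h1 := (hΩ _ (Metric.mem_ball.2 (htb.trans_le (by linarith)))).1 htΩ
          rw [apply_chart_zero, apply_chart_one] at h1
          obtain ⟨y, hy, hyt⟩ := Metric.mem_thickening_iff.1 htδ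
          have hyb : y ∈ Metric.ball x₀ r := by
            rw [Metric.mem_ball]
            have := dist_triangle y (chart R (s, t)) x₀
            rw [dist_comm y (chart R (s, t))] at this
            linarith
          have h2 : R y 1 ≤ γ (R y 0) := not_lt.1 fun h => hy ((hΩ y hyb).2 h)
          have h3 := hRd (chart R (s, t)) y 0
          have h4 := hRd (chart R (s, t)) y 1
          have h5 := hlip (R y 0) s
          rw [apply_chart_zero, abs_sub_comm] at h3
          rw [apply_chart_one] at h4
          have h6 : K * |R y 0 - s| ≤ K * δ := mul_le_mul_of_nonneg_left (h3.trans hyt.le) hK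
          refine ⟨h1, ?_⟩
          have h7 := (abs_le.1 h4).2
          have h8 := (abs_le.1 h5).2
          linarith
        refine (lintegral_mono_set hsub).trans ?_
        have h9 : ∀ t ∈ Ioc (γ s) (γ s + (1 + K) * δ), ‖φ (chart R (s, t))‖ₑ ^ 2 ≤ c * F s :=
          fun t ht => hpt s t ⟨ht.1.le, ht.2.trans (by linarith)⟩
        refine (setLIntegral_mono' measurableSet_Ioc h9).trans_eq ?_
        rw [setLIntegral_const, Real.volume_Ioc, add_sub_cancel_left,
          ENNReal.ofReal_mul (by positivity)]
        have : ENNReal.ofReal (1 + (K : ℝ)) = ((1 + K : ℝ≥0) : ℝ≥0∞) := by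
          rw [← ENNReal.ofReal_coe_nnreal]
          simp
        rw [this]
        ring
      · rw [indicator_of_notMem hs]
        have : {t | chart R (s, t) ∈ Ω ∩ Metric.ball x₀ ρ ∩ Metric.thickening δ Ωᶜ} = ∅ := by
          refine eq_empty_iff_forall_notMem.2 fun t ht => hs ?_
          simpa [apply_chart_zero] using hmemI _ ht.1.2
        rw [this, Measure.restrict_empty, lintegral_zero_measure]
    refine (lintegral_mono hpt2).trans ?_
    rw [lintegral_indicator hIm, lintegral_const_mul' _ _ (by finiteness)]
    gcongr

theorem lintegral_biUnion_finset_le {α ι : Type*} [MeasurableSpace α] {μ : Measure α}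
    (T : Finset ι) (s : ι → Set α) (f : α → ℝ≥0∞) :
    ∫⁻ x in ⋃ i ∈ T, s i, f x ∂μ ≤ ∑ i ∈ T, ∫⁻ x in s i, f x ∂μ := by
  have h := lintegral_iUnion_le (μ := μ) (fun i : T => s i) f
  rwa [tsum_fintype, Finset.sum_coe_sort T (fun i => ∫⁻ x in s i, f x ∂μ),
    iUnion_subtype (· ∈ T) (fun i => s i)] at h

/-- For a bounded Lipschitz domain and smooth functions, the `L²(∂Ω)` norm is controlled by the
`H¹(Ω)` norm, and the squared `L²` norm over the points at distance less than `δ` from the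
complement is `O(δ)` times the squared `H¹(Ω)` norm. -/
theorem exists_boundary_estimates {Ω : Set Plane} (ho : IsOpen Ω) (hb : Bornology.IsBounded Ω)
    (hL : HasLipschitzBoundary Ω) :
    ∃ δ₀ > 0, ∃ C : ℝ≥0∞, C ≠ ⊤ ∧ ∀ φ : Plane → ℂ, ContDiff ℝ ∞ φ →
      (∫⁻ x, ‖φ x‖ₑ ^ 2 ∂(boundaryMeasure Ω) ≤ C * ∫⁻ x in Ω, energyDensity φ x) ∧
      ∀ δ : ℝ, 0 < δ → δ ≤ δ₀ →
        ∫⁻ x in Ω ∩ Metric.thickening δ Ωᶜ, ‖φ x‖ₑ ^ 2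
          ≤ C * ENNReal.ofReal δ * ∫⁻ x in Ω, energyDensity φ x := by
  choose! ρ hρ δ hδ C hC h using fun x₀ (hx₀ : x₀ ∈ frontier Ω) =>
    exists_local_boundary_estimates ho hL hx₀
  have hcl : IsCompact (closure Ω) := hb.isCompact_closure
  have hfc : IsCompact (frontier Ω) :=
    hcl.of_isClosed_subset isClosed_frontier frontier_subset_closure
  obtain ⟨T, hT, hcov⟩ := hfc.elim_nhds_subcover (fun x => Metric.ball x (ρ x))
    fun x hx => Metric.ball_mem_nhds x (hρ x hx)
  -- the part of the closure outside the chosen balls has positive distance to the complement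
  set V : Set Plane := ⋃ x ∈ T, Metric.ball x (ρ x)
  have hV : IsOpen V := isOpen_biUnion fun x _ => Metric.isOpen_ball
  obtain ⟨δ₁, hδ₁, hsub⟩ : ∃ δ₁ > 0, Metric.cthickening δ₁ (closure Ω \ V) ⊆ Ω := by
    refine (hcl.diff hV).exists_cthickening_subset_open ho ?_
    rintro x ⟨hx, hxV⟩
    by_contra hxΩ
    exact hxV (hcov (ho.frontier_eq ▸ ⟨hx, hxΩ⟩))
  have hne : ∃ δ₂ > 0, ∀ x ∈ T, δ₂ ≤ δ x := by
    rcases T.eq_empty_or_nonempty with rfl | hTne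
    · exact ⟨1, one_pos, by simp⟩
    · exact ⟨T.inf' hTne δ, (Finset.lt_inf'_iff hTne).2 fun x hx => hδ x (hT x hx),
        fun x hx => Finset.inf'_le δ hx⟩
  obtain ⟨δ₂, hδ₂, hδ₂'⟩ := hne
  refine ⟨min δ₁ δ₂, lt_min hδ₁ hδ₂, ∑ x ∈ T, C x,
    ENNReal.sum_ne_top.2 fun x hx => hC x (hT x hx), fun φ hφ => ⟨?_, fun d hd hd₀ => ?_⟩⟩
  · have hsub : frontier Ω ⊆ ⋃ x ∈ T, frontier Ω ∩ Metric.ball x (ρ x) := by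
      rw [← inter_iUnion₂]
      exact fun x hx => ⟨hx, hcov hx⟩
    rw [boundaryMeasure, Finset.sum_mul]
    refine (lintegral_mono_set hsub).trans ((lintegral_biUnion_finset_le _ _ _).trans ?_)
    exact Finset.sum_le_sum fun x hx => (h x (hT x hx) φ hφ).1
  · have hsub : Ω ∩ Metric.thickening d Ωᶜ ⊆
        ⋃ x ∈ T, Ω ∩ Metric.ball x (ρ x) ∩ Metric.thickening d Ωᶜ := by
      rintro x ⟨hx, hxd⟩
      have hxV : x ∈ V := by
        by_contra hxV
        obtain ⟨y, hy, hyx⟩ := Metric.mem_thickening_iff.1 hxd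
        refine hy (hsub ?_)
        refine Metric.mem_cthickening_of_dist_le y x _ _ ⟨subset_closure hx, hxV⟩ ?_
        rw [dist_comm]
        exact hyx.le.trans (hd₀.trans (min_le_left _ _))
      obtain ⟨z, hz, hxz⟩ := mem_iUnion₂.1 hxV
      exact mem_iUnion₂.2 ⟨z, hz, ⟨hx, hxz⟩, hxd⟩
    rw [Finset.sum_mul, Finset.sum_mul]
    refine (lintegral_mono_set hsub).trans ((lintegral_biUnion_finset_le _ _ _).trans ?_)
    exact Finset.sum_le_sum fun x hx => (h x (hT x hx) φ hφ).2 d hd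
      ((hd₀.trans (min_le_right _ _)).trans (hδ₂' x hx))

/-! ### The Poincaré inequality on squares -/

/-- The half-open square with lower left corner `(a, b)` and side length `h`. -/
def square (a b h : ℝ) : Set Plane := {x | x 0 ∈ Ioc a (a + h) ∧ x 1 ∈ Ioc b (b + h)}

theorem measurableSet_square (a b h : ℝ) : MeasurableSet (square a b h) := by
  have hc : ∀ i : Fin 2, Measurable fun x : Plane => x i := fun i =>
    (EuclideanSpace.proj (𝕜 := ℝ) i).continuous.measurable
  exact (hc 0 measurableSet_Ioc).inter (hc 1 measurableSet_Ioc)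

theorem setLIntegral_square (a b h : ℝ) {g : Plane → ℝ≥0∞} (hg : Measurable g) :
    ∫⁻ x in square a b h, g x = ∫⁻ s in Ioc a (a + h), ∫⁻ t in Ioc b (b + h),
      g (chart (LinearIsometryEquiv.refl ℝ Plane) (s, t)) := by
  rw [setLIntegral_chart (.refl ℝ Plane) hg (measurableSet_square a b h),
    ← lintegral_indicator measurableSet_Ioc]
  refine lintegral_congr fun s => ?_
  have h0 : ∀ t, chart (.refl ℝ Plane) (s, t) ∈ square a b h ↔
      s ∈ Ioc a (a + h) ∧ t ∈ Ioc b (b + h) := fun t => Iff.rfl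
  simp only [h0]
  by_cases hs : s ∈ Ioc a (a + h)
  · simp only [hs, true_and, indicator_of_mem]
    rfl
  · rw [indicator_of_notMem hs]
    simp [hs]

theorem volume_square (a b h : ℝ) : volume (square a b h) = ENNReal.ofReal h ^ 2 := by
  rw [← setLIntegral_one, setLIntegral_square a b h measurable_const]
  simp [sq]

theorem dist_lt_of_mem_square {a b h : ℝ} {x y : Plane} (hx : x ∈ square a b h)
    (hy : y ∈ square a b h) : dist x y < 2 * h := by
  have h1 : dist x y ≤ |x 0 - y 0| + |x 1 - y 1| := by
    rw [dist_eq_norm, ← chart_apply (.refl ℝ Plane) x, ← chart_apply (.refl ℝ Plane) y, chart_sub]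
    exact norm_chart_le _ _
  have h2 : |x 0 - y 0| < h := by
    rw [abs_lt]; constructor <;> linarith [hx.1.1, hx.1.2, hy.1.1, hy.1.2]
  have h3 : |x 1 - y 1| < h := by
    rw [abs_lt]; constructor <;> linarith [hx.2.1, hx.2.2, hy.2.1, hy.2.2]
  linarith

theorem integrableOn_of_isBounded {φ : Plane → ℂ} (hφ : Continuous φ) {S : Set Plane}
    (hS : Bornology.IsBounded S) : IntegrableOn φ S :=
  (hφ.continuousOn.integrableOn_compact hS.isCompact_closure).mono_set subset_closure

/-- The Poincaré inequality on a square, for smooth functions. -/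
theorem setLIntegral_square_enorm_sq_le {φ : Plane → ℂ} (hφ : ContDiff ℝ ∞ φ) (a b : ℝ) {h : ℝ}
    (hh : 0 < h) :
    ∫⁻ x in square a b h, ‖φ x‖ₑ ^ 2 ≤
      8 * ENNReal.ofReal h ^ 2 * (∫⁻ x in square a b h, ‖fderiv ℝ φ x‖ₑ ^ 2) +
        2 * (ENNReal.ofReal h ^ 2)⁻¹ * ‖∫ x in square a b h, φ x‖ₑ ^ 2 := by
  set S := square a b h with hS
  set Φ : ℝ × ℝ → Plane := chart (LinearIsometryEquiv.refl ℝ Plane) with hΦ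
  have hΦc : Continuous Φ := continuous_chart _
  set η := ENNReal.ofReal h with hη
  have hSm : MeasurableSet S := measurableSet_square a b h
  have hSvol : volume S = η ^ 2 := volume_square a b h
  set G : Plane → ℝ≥0∞ := fun x => ‖fderiv ℝ φ x‖ₑ ^ 2 with hG
  have hGm : Measurable G := by
    have : Continuous (fderiv ℝ φ) := hφ.continuous_fderiv (by simp)
    fun_prop
  have hφc := hφ.continuous
  set D := ∫⁻ x in S, G x with hD
  set A : ℝ → ℝ≥0∞ := fun t => ∫⁻ s in Ioc a (a + h), G (Φ (s, t)) with hA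
  set B : ℝ → ℝ≥0∞ := fun s => ∫⁻ t in Ioc b (b + h), G (Φ (s, t)) with hB
  have hGΦ : Measurable fun p => G (Φ p) := hGm.comp hΦc.measurable
  have hAm : Measurable A := Measurable.lintegral_prod_left' hGΦ
  have hBm : Measurable B := Measurable.lintegral_prod_right' hGΦ
  have hcoord : ∀ i : Fin 2, Measurable fun x : Plane => x i := fun i =>
    (EuclideanSpace.proj (𝕜 := ℝ) i).continuous.measurable
  have hA1 : Measurable fun x : Plane => A (x 1) := hAm.comp (hcoord 1)
  have hB0 : Measurable fun x : Plane => B (x 0) := hBm.comp (hcoord 0)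
  have hIA : ∫⁻ x in S, A (x 1) = η * D := by
    rw [hD, hS, setLIntegral_square a b h hA1, setLIntegral_square a b h hGm]
    rw [lintegral_lintegral_swap (f := fun s t => G (Φ (s, t))) hGΦ.aemeasurable]
    have : ∀ s t, Φ (s, t) 1 = t := fun s t => rfl
    simp only [← hΦ, this]
    rw [setLIntegral_const, Real.volume_Ioc, add_sub_cancel_left, mul_comm]
  have hIB : ∫⁻ x in S, B (x 0) = η * D := by
    rw [hD, hS, setLIntegral_square a b h hB0, setLIntegral_square a b h hGm]
    have : ∀ s t, Φ (s, t) 0 = s := fun s t => rfl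
    simp only [← hΦ, this, setLIntegral_const, Real.volume_Ioc, add_sub_cancel_left]
    rw [lintegral_mul_const _ hBm, mul_comm]
  -- oscillation along the two sides of the polygonal path from `x` to `y` parallel to the axes
  have hosc : ∀ x ∈ S, ∀ y ∈ S, ‖φ x - φ y‖ₑ ^ 2 ≤ 2 * η * A (x 1) + 2 * η * B (y 0) := by
    intro x hx y hy
    have hx' : x = Φ (x 0, x 1) := (chart_apply (.refl ℝ Plane) x).symm
    have hy' : y = Φ (y 0, y 1) := (chart_apply (.refl ℝ Plane) y).symm
    have hv0 : ‖Φ (1, 0)‖ ≤ 1 := by simpa using norm_chart_le (.refl ℝ Plane) (1, 0)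
    have hv1 : ‖Φ (0, 1)‖ ≤ 1 := by simpa using norm_chart_le (.refl ℝ Plane) (0, 1)
    have he1 : ∀ s t, Φ (s, t) = Φ (s, 0) + t • Φ (0, 1) := chart_eq _
    have he0 : ∀ s t, Φ (s, t) = Φ (0, t) + s • Φ (1, 0) := fun s t => by
      simp only [hΦ, chart, ← map_smul, ← map_add]
      congr 1
      ext i; fin_cases i <;> simp
    have h1 := enorm_sub_sq_le (contDiff_line hφ (Φ (0, x 1)) (Φ (1, 0)))
      (Ioc_subset_Icc_self hx.1) (Ioc_subset_Icc_self hy.1)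
    have h2 := enorm_sub_sq_le (contDiff_line hφ (Φ (y 0, 0)) (Φ (0, 1)))
      (Ioc_subset_Icc_self hx.2) (Ioc_subset_Icc_self hy.2)
    have h1' := fun s => enorm_deriv_line_le hφ (Φ (0, x 1)) hv0 s
    have h2' := fun s => enorm_deriv_line_le hφ (Φ (y 0, 0)) hv1 s
    simp only [← he0, ← he1, add_sub_cancel_left] at h1 h2 h1' h2'
    have h3 := enorm_sq_le_add (φ x - φ y) (φ (Φ (y 0, x 1)) - φ y)
    rw [sub_sub_sub_cancel_right] at h3
    refine h3.trans ?_
    rw [mul_assoc, mul_assoc]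
    refine add_le_add ?_ ?_
    · gcongr
      rw [← hx'] at h1
      refine h1.trans (mul_le_mul_right (lintegral_mono fun s => ?_) _)
      exact pow_le_pow_left' (h1' s) 2
    · gcongr
      rw [← hy'] at h2
      refine h2.trans (mul_le_mul_right (lintegral_mono fun s => ?_) _)
      exact pow_le_pow_left' (h2' s) 2
  have hSfin : volume S ≠ ⊤ := by rw [hSvol]; finiteness
  have hint : IntegrableOn φ S := integrableOn_of_isBounded hφc
    (Metric.isBounded_iff.2 ⟨2 * h, fun x hx y hy => (dist_lt_of_mem_square hx hy).le⟩)
  have hx : ∀ x ∈ S, η ^ 4 * ‖φ x‖ₑ ^ 2 ≤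
      2 * (η ^ 2 * (2 * η * (η ^ 2 * A (x 1)) + 2 * η * (η * D))) +
        2 * ‖∫ y in S, φ y‖ₑ ^ 2 := by
    intro x hx
    have h1 : (h ^ 2 : ℝ) • φ x - ∫ y in S, φ y = ∫ y in S, (φ x - φ y) := by
      have hc : IntegrableOn (fun _ : Plane => φ x) S := integrableOn_const hSfin (by simp)
      rw [integral_sub hc hint, setIntegral_const, Measure.real, hSvol, hη,
        ← ENNReal.ofReal_pow hh.le, ENNReal.toReal_ofReal (by positivity)]
    have h2 := enorm_sq_le_add ((h ^ 2 : ℝ) • φ x) (∫ y in S, φ y)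
    have h3 : ‖(h ^ 2 : ℝ) • φ x‖ₑ ^ 2 = η ^ 4 * ‖φ x‖ₑ ^ 2 := by
      rw [enorm_smul, mul_pow, Real.enorm_eq_ofReal (by positivity), ENNReal.ofReal_pow hh.le]
      ring
    rw [h3, h1] at h2
    refine h2.trans ?_
    gcongr
    refine (pow_le_pow_left' (enorm_integral_le_lintegral_enorm _) 2).trans
      ((sq_lintegral_le (by fun_prop)).trans ?_)
    rw [Measure.restrict_apply_univ, hSvol]
    gcongr
    refine (setLIntegral_mono' hSm fun y hy => hosc x hx y hy).trans_eq ?_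
    rw [lintegral_add_left (by fun_prop), setLIntegral_const, hSvol,
      lintegral_const_mul _ hB0, hIB]
    ring
  have hfin := setLIntegral_mono' hSm hx (μ := volume)
  rw [lintegral_const_mul _ (by fun_prop), lintegral_add_right _ measurable_const,
    setLIntegral_const, hSvol, lintegral_const_mul _ (by fun_prop),
    lintegral_const_mul _ (by fun_prop), lintegral_add_right _ measurable_const,
    setLIntegral_const, lintegral_const_mul _ (by fun_prop), lintegral_const_mul _ (by fun_prop),
    hIA, hSvol] at hfin
  have hη0 : η ≠ 0 := by simpa [hη] using hh
  have h4 : (η ^ 4)⁻¹ * η ^ 4 = 1 := ENNReal.inv_mul_cancel (by positivity) (by finiteness)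
  have h5 : (η ^ 4)⁻¹ * η ^ 2 = (η ^ 2)⁻¹ := by
    rw [show η ^ 4 = η ^ 2 * η ^ 2 by ring, ENNReal.mul_inv (by simp [hη0]) (by simp [hη0]),
      mul_assoc, ENNReal.inv_mul_cancel (by positivity) (by finiteness), mul_one]
  calc ∫⁻ x in S, ‖φ x‖ₑ ^ 2 = (η ^ 4)⁻¹ * (η ^ 4 * ∫⁻ x in S, ‖φ x‖ₑ ^ 2) := by
        rw [← mul_assoc, h4, one_mul]
    _ ≤ _ := mul_le_mul_right hfin _
    _ = ((η ^ 4)⁻¹ * η ^ 4) * (8 * η ^ 2 * D) +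
        2 * ((η ^ 4)⁻¹ * η ^ 2) * ‖∫ y in S, φ y‖ₑ ^ 2 := by ring
    _ = _ := by rw [h4, h5, one_mul]

/-- The inequality behind Rellich's theorem: up to finitely many averages, the `L²(Ω)` norm is
small compared with the `H¹(Ω)` norm. A grid of small squares is used: on the squares inside `Ω`
the Poincaré inequality applies, and the other squares only meet `Ω` in a thin boundary strip. -/
theorem exists_finite_averages_bound {Ω : Set Plane} (ho : IsOpen Ω)
    (hb : Bornology.IsBounded Ω) (hL : HasLipschitzBoundary Ω) {ε : ℝ} (hε : 0 < ε) :
    ∃ (h : ℝ) (T : Finset (ℝ × ℝ)) (C : ℝ≥0∞), C ≠ ⊤ ∧ (∀ p ∈ T, square p.1 p.2 h ⊆ Ω) ∧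
      ∀ φ : Plane → ℂ, ContDiff ℝ ∞ φ →
        ∫⁻ x in Ω, ‖φ x‖ₑ ^ 2 ≤ ENNReal.ofReal ε * (∫⁻ x in Ω, energyDensity φ x) +
          C * ∑ p ∈ T, ‖∫ x in square p.1 p.2 h, φ x‖ₑ ^ 2 := by
  classical
  obtain ⟨δ₀, hδ₀, C₀, hC₀, hest⟩ := exists_boundary_estimates ho hb hL
  obtain ⟨h, hh, hh1, hh2⟩ : ∃ h : ℝ, 0 < h ∧ 2 * h ≤ δ₀ ∧
      8 * h ^ 2 + C₀.toReal * (2 * h) ≤ ε := by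
    have hc : Tendsto (fun h : ℝ => 8 * h ^ 2 + C₀.toReal * (2 * h)) (𝓝[>] 0) (𝓝 0) := by
      have : Continuous fun h : ℝ => 8 * h ^ 2 + C₀.toReal * (2 * h) := by fun_prop
      simpa using (this.tendsto 0).mono_left nhdsWithin_le_nhds
    have h1 := hc.eventually_le_const hε
    have h2 : ∀ᶠ h : ℝ in 𝓝[>] 0, h ≤ δ₀ / 2 :=
      (tendsto_nhdsWithin_of_tendsto_nhds tendsto_id).eventually_le_const (by positivity)
    obtain ⟨h, h3, h4, h5⟩ := (h1.and (h2.and self_mem_nhdsWithin)).exists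
    exact ⟨h, h5, by linarith, h3⟩
  obtain ⟨M, hM⟩ := hb.subset_closedBall 0
  set N : ℤ := ⌈M / h⌉ with hN
  set idx : Plane → ℤ × ℤ := fun x => (⌈x 0 / h⌉, ⌈x 1 / h⌉) with hidx
  set cnr : ℤ × ℤ → ℝ × ℝ := fun z => (h * (z.1 - 1), h * (z.2 - 1)) with hcnr
  have hmem : ∀ x z, x ∈ square (cnr z).1 (cnr z).2 h ↔ idx x = z := by
    rintro x ⟨z, w⟩
    have key : ∀ (t : ℝ) (z : ℤ), t ∈ Ioc (h * (z - 1)) (h * (z - 1) + h) ↔ ⌈t / h⌉ = z := by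
      intro t z
      rw [Int.ceil_eq_iff, lt_div_iff₀ hh, div_le_iff₀ hh, mem_Ioc, mul_comm h]
      have : ((z : ℝ) - 1) * h + h = z * h := by ring
      rw [this]
    simp only [square, mem_ofPred_eq, hcnr, key, hidx, Prod.mk.injEq]
  have hidxM : ∀ x ∈ Ω, idx x ∈ Finset.Icc (-N) N ×ˢ Finset.Icc (-N) N := by
    intro x hx
    have key : ∀ i : Fin 2, ⌈x i / h⌉ ∈ Finset.Icc (-N) N := by
      intro i
      have h1 : |x i| ≤ M := (PiLp.norm_apply_le x i).trans (by simpa using hM hx)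
      have h2 : x i / h ≤ M / h := by gcongr; exact (abs_le.1 h1).2
      have h3 : -(M / h) ≤ x i / h := by
        rw [← neg_div]; gcongr; exact (abs_le.1 h1).1
      rw [Finset.mem_Icc]
      refine ⟨?_, Int.ceil_le_ceil h2⟩
      have h4 : -(N : ℝ) ≤ ⌈x i / h⌉ :=
        (neg_le_neg (Int.le_ceil _)).trans (h3.trans (Int.le_ceil _))
      exact_mod_cast h4
    exact Finset.mem_product.2 ⟨key 0, key 1⟩
  set Z : Finset (ℤ × ℤ) := (Finset.Icc (-N) N ×ˢ Finset.Icc (-N) N).filter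
    fun z => square (cnr z).1 (cnr z).2 h ⊆ Ω with hZ
  have hZsub : ∀ z ∈ Z, square (cnr z).1 (cnr z).2 h ⊆ Ω := fun z hz => (Finset.mem_filter.1 hz).2
  have hZmem : ∀ x ∈ Ω, square (cnr (idx x)).1 (cnr (idx x)).2 h ⊆ Ω → idx x ∈ Z :=
    fun x hx hs => Finset.mem_filter.2 ⟨hidxM x hx, hs⟩
  have hcnr_inj : Function.Injective cnr := by
    rintro ⟨a, b⟩ ⟨c, d⟩ heq
    simp only [hcnr, Prod.mk.injEq, mul_eq_mul_left_iff, hh.ne', or_false, sub_left_inj,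
      Int.cast_inj] at heq
    exact Prod.ext heq.1 heq.2
  clear_value Z idx cnr
  refine ⟨h, Z.image cnr, 2 * (ENNReal.ofReal h ^ 2)⁻¹, ?_, ?_, fun φ hφ => ?_⟩
  · refine ENNReal.mul_ne_top (by simp) (ENNReal.inv_ne_top.2 ?_)
    simpa using hh
  · intro p hp
    obtain ⟨z, hz, rfl⟩ := Finset.mem_image.1 hp
    exact hZsub z hz
  · rw [Finset.sum_image hcnr_inj.injOn]
    set E := ∫⁻ x in Ω, energyDensity φ x with hE
    have hcov : Ω ⊆ (⋃ z ∈ Z, square (cnr z).1 (cnr z).2 h) ∪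
        (Ω ∩ Metric.thickening (2 * h) Ωᶜ) := by
      intro x hx
      by_cases hs : square (cnr (idx x)).1 (cnr (idx x)).2 h ⊆ Ω
      · exact Or.inl (mem_iUnion₂.2
          ⟨idx x, hZmem x hx hs, (hmem _ _).2 rfl⟩)
      · obtain ⟨y, hy, hyΩ⟩ := not_subset.1 hs
        exact Or.inr ⟨hx, Metric.mem_thickening_iff.2
          ⟨y, hyΩ, dist_lt_of_mem_square ((hmem _ _).2 rfl) hy⟩⟩
    have hgrad : ∑ z ∈ Z, ∫⁻ x in square (cnr z).1 (cnr z).2 h, ‖fderiv ℝ φ x‖ₑ ^ 2 ≤ E := by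
      rw [← lintegral_biUnion_finset]
      · refine (lintegral_mono_set (iUnion₂_subset hZsub)).trans (lintegral_mono fun x => ?_)
        exact le_add_self
      · intro z _ w _ hzw
        exact disjoint_left.2 fun x hxz hxw => hzw (((hmem _ _).1 hxz).symm.trans ((hmem _ _).1 hxw))
      · exact fun z _ => measurableSet_square _ _ _
    have hcoef : 8 * ENNReal.ofReal h ^ 2 + C₀ * ENNReal.ofReal (2 * h) ≤ ENNReal.ofReal ε := by
      refine le_trans (le_of_eq ?_) (ENNReal.ofReal_le_ofReal hh2)
      rw [ENNReal.ofReal_add (by positivity) (by positivity), ENNReal.ofReal_mul (p := 8) (by simp),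
        ENNReal.ofReal_mul (p := C₀.toReal) (by simp), ENNReal.ofReal_toReal hC₀,
        ENNReal.ofReal_pow hh.le]
      norm_num
    calc ∫⁻ x in Ω, ‖φ x‖ₑ ^ 2
        ≤ (∑ z ∈ Z, ∫⁻ x in square (cnr z).1 (cnr z).2 h, ‖φ x‖ₑ ^ 2) +
          ∫⁻ x in Ω ∩ Metric.thickening (2 * h) Ωᶜ, ‖φ x‖ₑ ^ 2 := by
          refine (lintegral_mono_set hcov).trans ((lintegral_union_le _ _ _).trans ?_)
          exact add_le_add_left (lintegral_biUnion_finset_le _ _ _) _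
      _ ≤ (∑ z ∈ Z, (8 * ENNReal.ofReal h ^ 2 *
            (∫⁻ x in square (cnr z).1 (cnr z).2 h, ‖fderiv ℝ φ x‖ₑ ^ 2) +
            2 * (ENNReal.ofReal h ^ 2)⁻¹ * ‖∫ x in square (cnr z).1 (cnr z).2 h, φ x‖ₑ ^ 2)) +
          C₀ * ENNReal.ofReal (2 * h) * E := by
          exact add_le_add (Finset.sum_le_sum fun z _ =>
            setLIntegral_square_enorm_sq_le hφ _ _ hh) ((hest φ hφ).2 _ (by positivity) hh1)
      _ = 8 * ENNReal.ofReal h ^ 2 *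
            (∑ z ∈ Z, ∫⁻ x in square (cnr z).1 (cnr z).2 h, ‖fderiv ℝ φ x‖ₑ ^ 2) +
            C₀ * ENNReal.ofReal (2 * h) * E + 2 * (ENNReal.ofReal h ^ 2)⁻¹ *
            ∑ z ∈ Z, ‖∫ x in square (cnr z).1 (cnr z).2 h, φ x‖ₑ ^ 2 := by
          rw [Finset.sum_add_distrib, ← Finset.mul_sum, ← Finset.mul_sum]
          ring
      _ ≤ 8 * ENNReal.ofReal h ^ 2 * E + C₀ * ENNReal.ofReal (2 * h) * E +
            2 * (ENNReal.ofReal h ^ 2)⁻¹ *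
            ∑ z ∈ Z, ‖∫ x in square (cnr z).1 (cnr z).2 h, φ x‖ₑ ^ 2 :=
          add_le_add_left (add_le_add_left (mul_le_mul_right hgrad _) _) _
      _ ≤ _ := by
          rw [← add_mul]
          exact add_le_add_left (mul_le_mul_left hcoef _) _

/-! ### The Hilbert space `H¹(Ω)` and smooth functions in it -/

theorem eLpNorm_two_sq {α E : Type*} [MeasurableSpace α] {μ : Measure α} [NormedAddCommGroup E]
    (f : α → E) : eLpNorm f 2 μ ^ 2 = ∫⁻ x, ‖f x‖ₑ ^ 2 ∂μ := by
  have h := eLpNorm_nnreal_pow_eq_lintegral (f := f) (μ := μ) (p := 2) two_ne_zero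
  simpa using h

/-- Pairing an `L²` function with a fixed real `L²` function is continuous. -/
theorem continuous_integral_smul {α E : Type*} [MeasurableSpace α] {μ : Measure α}
    [NormedAddCommGroup E] [NormedSpace ℝ E] {f : α → ℝ} (hf : MemLp f 2 μ) :
    Continuous fun u : Lp E 2 μ => ∫ x, f x • u x ∂μ := by
  have hint : ∀ u : Lp E 2 μ, Integrable (fun x => f x • u x) μ := fun u =>
    memLp_one_iff_integrable.1 ((Lp.memLp u).smul hf)
  set L : Lp E 2 μ →+ E :=
    { toFun := fun u => ∫ x, f x • u x ∂μ
      map_zero' := by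
        refine integral_eq_zero_of_ae ?_
        filter_upwards [Lp.coeFn_zero E 2 μ] with x hx
        rw [hx, Pi.zero_apply, smul_zero]
      map_add' := fun u v => by
        rw [← integral_add (hint u) (hint v)]
        refine integral_congr_ae ?_
        filter_upwards [Lp.coeFn_add u v] with x hx
        rw [hx, Pi.add_apply, smul_add] }
  refine AddMonoidHomClass.continuous_of_bound L (eLpNorm f 2 μ).toReal fun u => ?_
  have h : ‖L u‖ₑ ≤ eLpNorm f 2 μ * eLpNorm u 2 μ := by
    refine (enorm_integral_le_lintegral_enorm _).trans ?_
    rw [← eLpNorm_one_eq_lintegral_enorm]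
    exact eLpNorm_smul_le_mul_eLpNorm (Lp.memLp u).1 hf.1
  rw [← toReal_enorm, Lp.norm_def, ← ENNReal.toReal_mul]
  exact ENNReal.toReal_mono (ENNReal.mul_ne_top hf.2.ne (Lp.memLp u).2.ne) h

theorem isClosed_H1 (Ω : Set Plane) : IsClosed (H1 Ω : Set (WithLp 2 (L2 Ω × L2Vec Ω))) := by
  have : (H1 Ω : Set (WithLp 2 (L2 Ω × L2Vec Ω))) =
      ⋂ (φ : Plane → ℝ) (_ : IsTestFunction Ω φ) (i : Fin 2), {w | ∫ x in Ω,
        partialDeriv i φ x • w.fst x = -∫ x in Ω, φ x • w.snd x i} := by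
    ext w
    simp only [mem_iInter]
    rfl
  rw [this]
  refine isClosed_iInter fun φ => isClosed_iInter fun hφ => isClosed_iInter fun i => ?_
  have h1 : Continuous fun w : WithLp 2 (L2 Ω × L2Vec Ω) => w.fst := WithLp.continuous_fst ..
  have h2 : Continuous fun w : WithLp 2 (L2 Ω × L2Vec Ω) => w.snd := WithLp.continuous_snd ..
  refine isClosed_eq ((continuous_integral_smul (hφ.memLp_partialDeriv i)).comp h1) ?_
  have h3 : ∀ p : L2Vec Ω, ∫ x in Ω, φ x • p x i = (∫ x in Ω, φ x • p x) i := by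
    intro p
    have hint : Integrable (fun x => φ x • p x) (volume.restrict Ω) :=
      memLp_one_iff_integrable.1 ((Lp.memLp p).smul hφ.memLp)
    exact (EuclideanSpace.proj (𝕜 := ℂ) i).integral_comp_comm hint
  simp only [h3]
  exact ((EuclideanSpace.proj (𝕜 := ℂ) i).continuous.comp
    ((continuous_integral_smul hφ.memLp).comp h2)).neg

instance completeSpace_H1 (Ω : Set Plane) : CompleteSpace (H1 Ω) :=
  (isClosed_H1 Ω).completeSpace_coe

/-- The inclusion of `H¹(Ω)` into `L²(Ω)`. -/
def inclL2 (Ω : Set Plane) : H1 Ω →L[ℂ] L2 Ω :=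
  (WithLp.fstL 2 ℂ (L2 Ω) (L2Vec Ω)).comp (H1 Ω).subtypeL

/-- The weak gradient is unique. -/
theorem IsWeakGradient.unique {Ω : Set Plane} (ho : IsOpen Ω) {u : L2 Ω} {p q : L2Vec Ω}
    (hp : IsWeakGradient Ω u p) (hq : IsWeakGradient Ω u q) : p = q := by
  have h : ∀ i : Fin 2, ∀ᵐ x, x ∈ Ω → p x i - q x i = 0 := by
    intro i
    have hm : MemLp (fun x => p x i - q x i) 2 (volume.restrict Ω) :=
      (memLp_coord p i).sub (memLp_coord q i)
    have hloc : LocallyIntegrableOn (fun x => p x i - q x i) Ω :=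
      locallyIntegrableOn_of_locallyIntegrable_restrict (hm.locallyIntegrable one_le_two)
    refine ho.ae_eq_zero_of_integral_contDiff_smul_eq_zero hloc fun φ h1 h2 h3 => ?_
    have hφ : IsTestFunction Ω φ := ⟨h1, h2, h3⟩
    have h4 : ∫ x in Ω, φ x • (p x i - q x i) = 0 := by
      simp only [smul_sub]
      rw [integral_sub (integrable_smul hφ.memLp (memLp_coord p i))
        (integrable_smul hφ.memLp (memLp_coord q i)), sub_eq_zero, ← neg_inj, ← hp φ hφ i, hq φ hφ i]
    rwa [setIntegral_eq_integral_of_forall_compl_eq_zero] at h4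
    intro x hx
    rw [image_eq_zero_of_notMem_tsupport fun h => hx (h3 h), zero_smul]
  refine Lp.ext ((ae_restrict_iff' ho.measurableSet).2 ?_)
  filter_upwards [h 0, h 1] with x h0 h1 hx
  ext i
  fin_cases i
  · exact sub_eq_zero.1 (h0 hx)
  · exact sub_eq_zero.1 (h1 hx)

theorem H1.ext_toL2 {Ω : Set Plane} (ho : IsOpen Ω) {u v : H1 Ω} (h : H1.toL2 u = H1.toL2 v) :
    u = v := by
  have hv : IsWeakGradient Ω (H1.toL2 v) (H1.grad v) := v.2
  have hu : IsWeakGradient Ω (H1.toL2 v) (H1.grad u) := h ▸ u.2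
  exact Subtype.ext (WithLp.ofLp_injective 2 (Prod.ext h (hu.unique ho hv)))

/-- The gradient of a complex valued function on the plane, as a vector in `ℂ²`. -/
def gradient (φ : Plane → ℂ) (x : Plane) : EuclideanSpace ℂ (Fin 2) :=
  !₂[fderiv ℝ φ x (EuclideanSpace.single 0 1), fderiv ℝ φ x (EuclideanSpace.single 1 1)]

theorem gradient_apply (φ : Plane → ℂ) (x : Plane) (i : Fin 2) :
    gradient φ x i = fderiv ℝ φ x (EuclideanSpace.single i 1) := by
  fin_cases i <;> rfl

theorem norm_fderiv_le_norm_gradient (φ : Plane → ℂ) (x : Plane) :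
    ‖fderiv ℝ φ x‖ ≤ ‖gradient φ x‖ := by
  refine ContinuousLinearMap.opNorm_le_bound _ (norm_nonneg _) fun v => ?_
  have hv : v = v 0 • EuclideanSpace.single 0 (1 : ℝ) + v 1 • EuclideanSpace.single 1 (1 : ℝ) := by
    ext i; fin_cases i <;> simp
  have h1 : fderiv ℝ φ x v = v 0 • gradient φ x 0 + v 1 • gradient φ x 1 := by
    conv_lhs => rw [hv]
    rw [map_add, map_smul, map_smul, gradient_apply, gradient_apply]
  rw [h1, EuclideanSpace.norm_eq, EuclideanSpace.norm_eq, ← Real.sqrt_mul (by positivity)]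
  refine Real.le_sqrt_of_sq_le ?_
  rw [Fin.sum_univ_two, Fin.sum_univ_two]
  have h2 := norm_add_le (v 0 • gradient φ x 0) (v 1 • gradient φ x 1)
  rw [norm_smul, norm_smul] at h2
  refine (pow_le_pow_left₀ (norm_nonneg _) h2 2).trans ?_
  nlinarith [sq_nonneg (‖gradient φ x 0‖ * ‖v 1‖ - ‖gradient φ x 1‖ * ‖v 0‖)]

theorem continuous_gradient {φ : Plane → ℂ} (hφ : ContDiff ℝ ∞ φ) : Continuous (gradient φ) := by
  have h : Continuous (fderiv ℝ φ) := hφ.continuous_fderiv (by simp)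
  unfold gradient
  fun_prop

theorem isFiniteMeasure_restrict_of_isBounded {Ω : Set Plane} (hb : Bornology.IsBounded Ω) :
    IsFiniteMeasure ((volume : Measure Plane).restrict Ω) :=
  ⟨by rw [Measure.restrict_apply_univ]; exact hb.measure_lt_top⟩

theorem memLp_of_isBounded {E : Type*} [NormedAddCommGroup E] {Ω : Set Plane}
    (hb : Bornology.IsBounded Ω) {f : Plane → E} (hf : Continuous f)
    [SecondCountableTopologyEither Plane E] :
    MemLp f 2 (volume.restrict Ω) := by
  have := isFiniteMeasure_restrict_of_isBounded hb
  obtain ⟨C, hC⟩ := hb.isCompact_closure.exists_bound_of_continuousOn hf.continuousOn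
  refine MemLp.of_bound hf.aestronglyMeasurable C ?_
  have h : ∀ᵐ x ∂(volume.restrict (closure Ω)), ‖f x‖ ≤ C :=
    ae_restrict_of_forall_mem isClosed_closure.measurableSet hC
  exact ae_restrict_of_ae_restrict_of_subset subset_closure h

/-- The space of smooth functions on the plane. -/
def smoothFun : Submodule ℂ (Plane → ℂ) where
  carrier := {φ | ContDiff ℝ ∞ φ}
  zero_mem' := show ContDiff ℝ ∞ fun _ : Plane => (0 : ℂ) from contDiff_const
  add_mem' {φ ψ} (hφ : ContDiff ℝ ∞ φ) (hψ : ContDiff ℝ ∞ ψ) := hφ.add hψ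
  smul_mem' c φ (hφ : ContDiff ℝ ∞ φ) := hφ.const_smul c

theorem contDiff_smoothFun (φ : smoothFun) : ContDiff ℝ ∞ φ.1 := φ.2

theorem isWeakGradient_of_contDiff {Ω : Set Plane} (hb : Bornology.IsBounded Ω) {φ : Plane → ℂ}
    (hφ : ContDiff ℝ ∞ φ) :
    IsWeakGradient Ω ((memLp_of_isBounded hb hφ.continuous).toLp φ)
      ((memLp_of_isBounded hb (continuous_gradient hφ)).toLp (gradient φ)) := by
  intro ψ hψ i
  have h1 : ∫ x in Ω, partialDeriv i ψ x • (memLp_of_isBounded hb hφ.continuous).toLp φ x =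
      ∫ x, partialDeriv i ψ x • φ x := by
    rw [← setIntegral_eq_integral_of_forall_compl_eq_zero (s := Ω)
      (f := fun x => partialDeriv i ψ x • φ x)]
    · refine integral_congr_ae ?_
      filter_upwards [(memLp_of_isBounded hb hφ.continuous).coeFn_toLp] with x hx
      rw [hx]
    · intro x hx
      have h0 : fderiv ℝ ψ x = 0 := image_eq_zero_of_notMem_tsupport fun h =>
        hx (hψ.support (tsupport_fderiv_subset ℝ h))
      rw [partialDeriv, h0]
      simp
  have h2 : ∫ x in Ω, ψ x • (memLp_of_isBounded hb (continuous_gradient hφ)).toLp (gradient φ) x i =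
      ∫ x, ψ x • fderiv ℝ φ x (EuclideanSpace.single i 1) := by
    rw [← setIntegral_eq_integral_of_forall_compl_eq_zero (s := Ω)
      (f := fun x => ψ x • fderiv ℝ φ x (EuclideanSpace.single i 1))]
    · refine integral_congr_ae ?_
      filter_upwards [(memLp_of_isBounded hb (continuous_gradient hφ)).coeFn_toLp] with x hx
      rw [hx, gradient_apply]
    · intro x hx
      rw [image_eq_zero_of_notMem_tsupport fun h => hx (hψ.support h), zero_smul]
  rw [h1, h2, eq_comm, neg_eq_iff_eq_neg]
  have hψc := hψ.smooth.continuous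
  have hφc := hφ.continuous
  have hψ' : Continuous (fderiv ℝ ψ) := hψ.smooth.continuous_fderiv (by simp)
  have hφ' : Continuous (fderiv ℝ φ) := hφ.continuous_fderiv (by simp)
  refine integral_bilinear_fderiv_right_eq_neg_left_of_integrable
    (B := ContinuousLinearMap.lsmul ℝ ℝ) ?_ ?_ ?_
    (fun x _ => hψ.smooth.differentiable (by simp) x) (fun x _ => hφ.differentiable (by simp) x)
  · exact Continuous.integrable_of_hasCompactSupport (by simp; fun_prop)
      ((hψ.compact.fderiv_apply (𝕜 := ℝ) _).smul_right)
  · exact Continuous.integrable_of_hasCompactSupport (by simp; fun_prop) hψ.compact.smul_right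
  · exact Continuous.integrable_of_hasCompactSupport (by simp; fun_prop) hψ.compact.smul_right

/-- The restriction to `Ω` of a smooth function on the plane, as an element of `H¹(Ω)`. -/
def H1.ofSmooth {Ω : Set Plane} (hb : Bornology.IsBounded Ω) (φ : Plane → ℂ)
    (hφ : ContDiff ℝ ∞ φ) : H1 Ω :=
  ⟨WithLp.toLp 2 ((memLp_of_isBounded hb hφ.continuous).toLp φ,
    (memLp_of_isBounded hb (continuous_gradient hφ)).toLp (gradient φ)),
    isWeakGradient_of_contDiff hb hφ⟩

/-- The linear map sending a smooth function on the plane to its restriction in `H¹(Ω)`. -/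
def smoothToH1 {Ω : Set Plane} (ho : IsOpen Ω) (hb : Bornology.IsBounded Ω) :
    smoothFun →ₗ[ℂ] H1 Ω where
  toFun φ := H1.ofSmooth hb φ.1 φ.2
  map_add' _ _ := H1.ext_toL2 ho rfl
  map_smul' _ _ := H1.ext_toL2 ho rfl

theorem coeFn_smoothToH1 {Ω : Set Plane} (ho : IsOpen Ω) (hb : Bornology.IsBounded Ω)
    (φ : smoothFun) : H1.toL2 (smoothToH1 ho hb φ) =ᵐ[volume.restrict Ω] φ.1 :=
  (memLp_of_isBounded hb (contDiff_smoothFun φ).continuous).coeFn_toLp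

theorem enorm_sq_withLp {E F : Type*} [NormedAddCommGroup E] [NormedAddCommGroup F]
    (w : WithLp 2 (E × F)) : ‖w‖ₑ ^ 2 = ‖w.fst‖ₑ ^ 2 + ‖w.snd‖ₑ ^ 2 := by
  have h := WithLp.prod_norm_sq_eq_of_L2 w
  have h2 : ‖w‖₊ ^ 2 = ‖w.fst‖₊ ^ 2 + ‖w.snd‖₊ ^ 2 := NNReal.eq (by push_cast; exact h)
  simp only [enorm]
  exact_mod_cast h2

theorem H1.enorm_sq {Ω : Set Plane} (u : H1 Ω) :
    ‖u‖ₑ ^ 2 = ‖H1.toL2 u‖ₑ ^ 2 + ‖H1.grad u‖ₑ ^ 2 :=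
  enorm_sq_withLp (u : WithLp 2 (L2 Ω × L2Vec Ω))

theorem lintegral_energyDensity_le {Ω : Set Plane} (ho : IsOpen Ω) (hb : Bornology.IsBounded Ω)
    (φ : smoothFun) :
    ∫⁻ x in Ω, energyDensity φ.1 x ≤ ‖smoothToH1 ho hb φ‖ₑ ^ 2 := by
  have h1 : Continuous φ.1 := (contDiff_smoothFun φ).continuous
  have h2 : ‖H1.toL2 (smoothToH1 ho hb φ)‖ₑ ^ 2 = ∫⁻ x in Ω, ‖φ.1 x‖ₑ ^ 2 := by
    rw [← eLpNorm_two_sq]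
    congr 1
    exact Lp.enorm_toLp (memLp_of_isBounded hb h1)
  have h3 : ‖H1.grad (smoothToH1 ho hb φ)‖ₑ ^ 2 = ∫⁻ x in Ω, ‖gradient φ.1 x‖ₑ ^ 2 := by
    rw [← eLpNorm_two_sq]
    congr 1
    exact Lp.enorm_toLp (memLp_of_isBounded hb (continuous_gradient (contDiff_smoothFun φ)))
  rw [H1.enorm_sq, h2, h3, ← lintegral_add_left (by fun_prop)]
  refine lintegral_mono fun x => ?_
  unfold energyDensity
  gcongr
  exact enorm_le_iff_norm_le.2 (norm_fderiv_le_norm_gradient φ.1 x)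

/-! ### Mollification -/

/-- Translation is continuous in `L²`. -/
theorem exists_lintegral_translate_sub_le {F : Plane → ℂ} (hF : MemLp F 2 volume) {ε : ℝ≥0∞}
    (hε : 0 < ε) :
    ∃ δ > 0, ∀ z ∈ Metric.ball (0 : Plane) δ, ∫⁻ x, ‖F (x - z) - F x‖ₑ ^ 2 ≤ ε ^ 2 := by
  have : Fact ((2 : ℝ≥0∞) ≠ ⊤) := ⟨by simp⟩
  set f : Lp ℂ 2 (volume : Measure Plane) := hF.toLp F with hf
  have hc : Continuous fun z : Plane => DomAddAct.mk (-z) +ᵥ f := by fun_prop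
  have h0 : DomAddAct.mk (-(0 : Plane)) +ᵥ f = f := by simp
  have h1 : ∀ᶠ z : Plane in 𝓝 0, (DomAddAct.mk (-z) +ᵥ f : Lp ℂ 2 (volume : Measure Plane)) ∈ Metric.eball f ε :=
    hc.continuousAt.eventually_mem (by
      rw [h0]; exact Metric.isOpen_eball.mem_nhds (Metric.mem_eball_self hε))
  obtain ⟨δ, hδ, h2⟩ := Metric.eventually_nhds_iff_ball.1 h1
  refine ⟨δ, hδ, fun z hz => ?_⟩
  have h3 := (Metric.mem_eball.1 (h2 z hz)).le
  rw [edist_eq_enorm_sub] at h3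
  have h4 : ‖(DomAddAct.mk (-z) +ᵥ f) - f‖ₑ = eLpNorm (fun x => F (x - z) - F x) 2 volume := by
    rw [Lp.enorm_def]
    refine eLpNorm_congr_ae ?_
    have h5 : (fun x => f (-z + x)) =ᵐ[volume] fun x => F (-z + x) :=
      (measurePreserving_add_left volume (-z)).quasiMeasurePreserving.ae_eq_comp hF.coeFn_toLp
    filter_upwards [Lp.coeFn_sub (DomAddAct.mk (-z) +ᵥ f) f,
      DomAddAct.vadd_Lp_ae_eq (DomAddAct.mk (-z)) f, hF.coeFn_toLp, h5] with x hx1 hx2 hx3 hx4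
    rw [hx1, Pi.sub_apply, hx2, hx3]
    change f (-z + x) - _ = _
    rw [hx4, neg_add_eq_sub]
  rw [h4] at h3
  rw [← eLpNorm_two_sq]
  exact pow_le_pow_left' h3 2

/-- Convolution of a real valued function with a complex valued one. -/
abbrev conv (ρ : Plane → ℝ) (F : Plane → ℂ) : Plane → ℂ :=
  convolution ρ F (ContinuousLinearMap.lsmul ℝ ℝ) volume

/-- Averages against a probability density supported near the origin approximate in `L²`. -/
theorem exists_lintegral_conv_sub_le {F : Plane → ℂ} (hF : MemLp F 2 volume)
    (hFm : Measurable F) {ε : ℝ≥0∞} (hε : 0 < ε) :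
    ∃ δ > 0, ∀ ρ : Plane → ℝ, Continuous ρ → HasCompactSupport ρ → (∀ x, 0 ≤ ρ x) →
      ∫ x, ρ x = 1 → Function.support ρ ⊆ Metric.ball 0 δ →
      ∫⁻ x, ‖conv ρ F x - F x‖ₑ ^ 2 ≤ ε ^ 2 := by
  obtain ⟨δ, hδ, h⟩ := exists_lintegral_translate_sub_le hF hε
  refine ⟨δ, hδ, fun ρ hρc hρs hρ0 hρ1 hρδ => ?_⟩
  have hρi : Integrable ρ := hρc.integrable_of_hasCompactSupport hρs
  have hρm : Measurable fun z => ENNReal.ofReal (ρ z) := hρc.measurable.ennreal_ofReal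
  set ν : Measure Plane := volume.withDensity fun z => ENNReal.ofReal (ρ z) with hν
  have hν1 : ν univ = 1 := by
    rw [hν, withDensity_apply _ MeasurableSet.univ, Measure.restrict_univ,
      ← ofReal_integral_eq_lintegral_ofReal hρi (.of_forall hρ0), hρ1, ENNReal.ofReal_one]
  have : IsProbabilityMeasure ν := ⟨hν1⟩
  have hexist := hρs.convolutionExists_left (ContinuousLinearMap.lsmul ℝ ℝ) hρc
    (hF.locallyIntegrable one_le_two)
  have hm2 : Measurable fun p : Plane × Plane => ‖F (p.1 - p.2) - F p.1‖ₑ ^ 2 := by fun_prop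
  have hpt : ∀ x, ‖conv ρ F x - F x‖ₑ ^ 2 ≤ ∫⁻ z, ‖F (x - z) - F x‖ₑ ^ 2 ∂ν := by
    intro x
    have h1 : conv ρ F x - F x = ∫ z, ρ z • (F (x - z) - F x) := by
      have h2 : F x = ∫ z, ρ z • F x := by rw [integral_smul_const, hρ1, one_smul]
      conv_lhs => rw [h2]
      rw [conv, convolution_def, ← integral_sub (hexist x) (hρi.smul_const _)]
      simp [smul_sub]
    have h3 : ‖conv ρ F x - F x‖ₑ ≤ ∫⁻ z, ‖F (x - z) - F x‖ₑ ∂ν := by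
      rw [h1, lintegral_withDensity_eq_lintegral_mul _ hρm (by fun_prop)]
      refine (enorm_integral_le_lintegral_enorm _).trans_eq (lintegral_congr fun z => ?_)
      rw [enorm_smul, Real.enorm_eq_ofReal (hρ0 z), Pi.mul_apply]
    refine (pow_le_pow_left' h3 2).trans ((sq_lintegral_le (by fun_prop)).trans_eq ?_)
    rw [hν1, one_mul]
  refine (lintegral_mono hpt).trans ?_
  rw [lintegral_lintegral_swap hm2.aemeasurable,
    lintegral_withDensity_eq_lintegral_mul _ hρm hm2.lintegral_prod_left']
  have h5 : ∀ z, ((fun z => ENNReal.ofReal (ρ z)) * fun z => ∫⁻ x, ‖F (x - z) - F x‖ₑ ^ 2) z ≤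
      ENNReal.ofReal (ρ z) * ε ^ 2 := by
    intro z
    by_cases hz : ρ z = 0
    · simp [hz]
    · exact mul_le_mul_right (h z (hρδ hz)) _
  refine (lintegral_mono h5).trans_eq ?_
  rw [lintegral_mul_const _ hρm, ← ofReal_integral_eq_lintegral_ofReal hρi (.of_forall hρ0), hρ1,
    ENNReal.ofReal_one, one_mul]

theorem contDiff_conv {ρ : Plane → ℝ} (hρ : ContDiff ℝ ∞ ρ) (hρs : HasCompactSupport ρ)
    {F : Plane → ℂ} (hF : MemLp F 2 volume) : ContDiff ℝ ∞ (conv ρ F) :=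
  hρs.contDiff_convolution_left _ hρ (hF.locallyIntegrable one_le_two)

theorem fderiv_conv_apply {ρ : Plane → ℝ} (hρ : ContDiff ℝ ∞ ρ) (hρs : HasCompactSupport ρ)
    {F : Plane → ℂ} (hF : MemLp F 2 volume) (i : Fin 2) (x : Plane) :
    fderiv ℝ (conv ρ F) x (EuclideanSpace.single i 1) = ∫ y, partialDeriv i ρ (x - y) • F y := by
  have hFl := hF.locallyIntegrable one_le_two
  have h1 := hρs.hasFDerivAt_convolution_left (ContinuousLinearMap.lsmul ℝ ℝ)
    (hρ.of_le (by exact_mod_cast le_top)) hFl x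
  have h2 : Continuous (fderiv ℝ ρ) := hρ.continuous_fderiv (by simp)
  have h3 := (hρs.fderiv ℝ).convolutionExists_left
    ((ContinuousLinearMap.lsmul ℝ ℝ).precompL Plane : _ →L[ℝ] ℂ →L[ℝ] _) h2 hFl x
  rw [h1.fderiv, convolution_def, ContinuousLinearMap.integral_apply h3]
  simp only [ContinuousLinearMap.precompL_apply, ContinuousLinearMap.lsmul_apply]
  rw [← integral_sub_left_eq_self _ volume x]
  simp [partialDeriv]

/-- `χ u`, extended by zero outside `Ω`. -/
def cutoffFun {Ω : Set Plane} (χ : Plane → ℝ) (u : H1 Ω) : Plane → ℂ :=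
  Ω.indicator fun y => χ y • H1.toL2 u y

/-- `∂ᵢ(χ u) = χ ∂ᵢu + u ∂ᵢχ`, extended by zero outside `Ω`. -/
def cutoffDeriv {Ω : Set Plane} (χ : Plane → ℝ) (u : H1 Ω) (i : Fin 2) : Plane → ℂ :=
  Ω.indicator fun y => χ y • H1.grad u y i + partialDeriv i χ y • H1.toL2 u y

theorem memLp_cutoff_smul {Ω : Set Plane} {χ : Plane → ℝ} (hχ : Continuous χ)
    (hχs : HasCompactSupport χ) {f : Plane → ℂ} (hf : MemLp f 2 (volume.restrict Ω)) :
    MemLp (fun y => χ y • f y) 2 (volume.restrict Ω) :=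
  hf.smul ((hχ.memLp_of_hasCompactSupport hχs : MemLp χ ⊤ volume).restrict Ω)

theorem continuous_partialDeriv {χ : Plane → ℝ} (hχ : ContDiff ℝ ∞ χ) (i : Fin 2) :
    Continuous (partialDeriv i χ) :=
  (hχ.continuous_fderiv (by simp)).clm_apply continuous_const

theorem hasCompactSupport_partialDeriv {χ : Plane → ℝ} (hχ : HasCompactSupport χ) (i : Fin 2) :
    HasCompactSupport (partialDeriv i χ) := hχ.fderiv_apply (𝕜 := ℝ) _

theorem memLp_cutoffFun {Ω : Set Plane} (ho : IsOpen Ω) {χ : Plane → ℝ} (hχ : ContDiff ℝ ∞ χ)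
    (hχs : HasCompactSupport χ) (u : H1 Ω) : MemLp (cutoffFun χ u) 2 volume :=
  (memLp_indicator_iff_restrict ho.measurableSet).2
    (memLp_cutoff_smul hχ.continuous hχs (Lp.memLp _))

theorem memLp_cutoffDeriv {Ω : Set Plane} (ho : IsOpen Ω) {χ : Plane → ℝ} (hχ : ContDiff ℝ ∞ χ)
    (hχs : HasCompactSupport χ) (u : H1 Ω) (i : Fin 2) : MemLp (cutoffDeriv χ u i) 2 volume :=
  (memLp_indicator_iff_restrict ho.measurableSet).2
    ((memLp_cutoff_smul hχ.continuous hχs (memLp_coord _ i)).add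
      (memLp_cutoff_smul (continuous_partialDeriv hχ i) (hasCompactSupport_partialDeriv hχs i)
        (Lp.memLp _)))

theorem measurable_cutoffFun {Ω : Set Plane} (ho : IsOpen Ω) {χ : Plane → ℝ}
    (hχ : ContDiff ℝ ∞ χ) (u : H1 Ω) : Measurable (cutoffFun χ u) :=
  (hχ.continuous.measurable.smul (Lp.stronglyMeasurable _).measurable).indicator ho.measurableSet

theorem measurable_cutoffDeriv {Ω : Set Plane} (ho : IsOpen Ω) {χ : Plane → ℝ}
    (hχ : ContDiff ℝ ∞ χ) (u : H1 Ω) (i : Fin 2) : Measurable (cutoffDeriv χ u i) := by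
  have h1 : Measurable fun y => H1.grad u y i :=
    (EuclideanSpace.proj (𝕜 := ℂ) i).continuous.measurable.comp (Lp.stronglyMeasurable _).measurable
  exact ((hχ.continuous.measurable.smul h1).add
    ((continuous_partialDeriv hχ i).measurable.smul
      (Lp.stronglyMeasurable _).measurable)).indicator ho.measurableSet

/-- Where the translated kernel only sees points of `Ω`, differentiation commutes with
convolution: `y ↦ χ(y) ρ(x - y)` is then an admissible test function. -/
theorem fderiv_conv_cutoffFun {Ω : Set Plane} (ho : IsOpen Ω) {χ ρ : Plane → ℝ}
    (hχ : ContDiff ℝ ∞ χ) (hχs : HasCompactSupport χ) (hρ : ContDiff ℝ ∞ ρ)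
    (hρs : HasCompactSupport ρ) (u : H1 Ω) (i : Fin 2) {x : Plane}
    (hx : ∀ y ∈ tsupport χ, x - y ∈ tsupport ρ → y ∈ Ω) :
    fderiv ℝ (conv ρ (cutoffFun χ u)) x (EuclideanSpace.single i 1) =
      conv ρ (cutoffDeriv χ u i) x := by
  set τ : Plane → ℝ := fun y => ρ (x - y) with hτ
  have hτd : ContDiff ℝ ∞ τ := hρ.comp (contDiff_const.sub contDiff_id)
  have hτs : tsupport τ ⊆ (fun y => x - y) ⁻¹' tsupport ρ :=
    tsupport_comp_subset_preimage ρ (by fun_prop)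
  have hψ : IsTestFunction Ω (fun y => χ y * τ y) := by
    refine ⟨hχ.mul hτd, hχs.mul_right, fun y hy => hx y (tsupport_mul_subset_left hy) ?_⟩
    exact hτs (tsupport_mul_subset_right hy)
  have hτ' : ∀ y, partialDeriv i τ y = -partialDeriv i ρ (x - y) := by
    intro y
    have h1 : HasFDerivAt τ (-(fderiv ℝ ρ (x - y))) y := by
      have h2 : HasFDerivAt τ ((fderiv ℝ ρ (x - y)).comp (-ContinuousLinearMap.id ℝ Plane)) y :=
        (hρ.differentiable (by simp) (x - y)).hasFDerivAt.comp y ((hasFDerivAt_id y).const_sub x)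
      rwa [ContinuousLinearMap.comp_neg, ContinuousLinearMap.comp_id] at h2
    rw [partialDeriv, h1.fderiv]
    rfl
  have hψ' : ∀ y, partialDeriv i (fun y => χ y * τ y) y =
      partialDeriv i χ y * τ y - χ y * partialDeriv i ρ (x - y) := by
    intro y
    rw [partialDeriv, fderiv_fun_mul (hχ.differentiable (by simp) y)
      (hτd.differentiable (by simp) y)]
    have := hτ' y
    simp only [partialDeriv] at this
    simp only [add_apply, smul_apply, this, partialDeriv,
      smul_eq_mul]
    ring
  have hmain := u.2 _ hψ i
  change ∫ y in Ω, partialDeriv i (fun y => χ y * τ y) y • H1.toL2 u y =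
    -∫ y in Ω, (χ y * τ y) • H1.grad u y i at hmain
  simp only [hψ', sub_smul] at hmain
  have hτc := hτd.continuous
  have hχc := hχ.continuous
  have hρc' := continuous_partialDeriv hρ i
  have hχc' := continuous_partialDeriv hχ i
  have hu : MemLp (H1.toL2 u) 2 (volume.restrict Ω) := Lp.memLp _
  have hp : MemLp (fun y => H1.grad u y i) 2 (volume.restrict Ω) := memLp_coord _ i
  have hi1 : Integrable (fun y => (partialDeriv i χ y * τ y) • H1.toL2 u y) (volume.restrict Ω) :=
    integrable_smul (((hχc'.mul hτc).memLp_of_hasCompactSupport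
      (hasCompactSupport_partialDeriv hχs i).mul_right).restrict Ω) hu
  have hi2 : Integrable (fun y => (χ y * partialDeriv i ρ (x - y)) • H1.toL2 u y)
      (volume.restrict Ω) :=
    integrable_smul (((hχc.mul (hρc'.comp (by fun_prop))).memLp_of_hasCompactSupport
      hχs.mul_right).restrict Ω) hu
  have hi3 : Integrable (fun y => (χ y * τ y) • H1.grad u y i) (volume.restrict Ω) :=
    integrable_smul (((hχc.mul hτc).memLp_of_hasCompactSupport hχs.mul_right).restrict Ω) hp
  rw [integral_sub hi1 hi2] at hmain
  have h1 : ∫ y, partialDeriv i ρ (x - y) • cutoffFun χ u y =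
      ∫ y in Ω, (χ y * partialDeriv i ρ (x - y)) • H1.toL2 u y := by
    rw [← integral_indicator ho.measurableSet]
    refine integral_congr_ae (.of_forall fun y => ?_)
    simp only [cutoffFun, indicator]
    split_ifs
    · simp only [smul_smul, mul_comm]
    · rw [smul_zero]
  have h2 : conv ρ (cutoffDeriv χ u i) x =
      ∫ y in Ω, ((χ y * τ y) • H1.grad u y i + (partialDeriv i χ y * τ y) • H1.toL2 u y) := by
    rw [conv, convolution_eq_swap, ← integral_indicator ho.measurableSet]
    refine integral_congr_ae (.of_forall fun y => ?_)
    simp only [cutoffDeriv, indicator, ContinuousLinearMap.lsmul_apply]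
    split_ifs
    · simp only [smul_smul, mul_comm, smul_add, hτ]
    · rw [smul_zero]
  rw [fderiv_conv_apply hρ hρs (memLp_cutoffFun ho hχ hχs u), h1, h2, integral_add hi3 hi1]
  linear_combination -hmain

/-! ### Density of smooth functions -/

theorem lintegral_enorm_sq_euclidean {α : Type*} [MeasurableSpace α] {μ : Measure α}
    {f : α → EuclideanSpace ℂ (Fin 2)} (hf : AEStronglyMeasurable f μ) :
    ∫⁻ x, ‖f x‖ₑ ^ 2 ∂μ = ∑ i, ∫⁻ x, ‖f x i‖ₑ ^ 2 ∂μ := by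
  have h : ∀ v : EuclideanSpace ℂ (Fin 2), ‖v‖ₑ ^ 2 = ‖v 0‖ₑ ^ 2 + ‖v 1‖ₑ ^ 2 := by
    intro v
    have h1 : ‖v‖ ^ 2 = ‖v 0‖ ^ 2 + ‖v 1‖ ^ 2 := by
      rw [EuclideanSpace.norm_sq_eq, Fin.sum_univ_two]
    have h2 : ‖v‖₊ ^ 2 = ‖v 0‖₊ ^ 2 + ‖v 1‖₊ ^ 2 := NNReal.eq (by push_cast; exact h1)
    simp only [enorm]
    exact_mod_cast h2
  have hm : ∀ i, AEStronglyMeasurable (fun x => f x i) μ := fun i =>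
    (EuclideanSpace.proj (𝕜 := ℂ) i).continuous.comp_aestronglyMeasurable hf
  rw [Fin.sum_univ_two, ← lintegral_add_left' ((hm 0).enorm.pow_const 2)]
  exact lintegral_congr fun x => h (f x)

/-- If arbitrarily small translated kernels connect the support of `χ` with `Ω` only through
points of `Ω`, then `χ u` is a limit in `H¹(Ω)` of smooth functions, namely of its mollifications
by these kernels. -/
theorem exists_cutoff_mem_closure {Ω : Set Plane} (ho : IsOpen Ω) (hb : Bornology.IsBounded Ω)
    {χ : Plane → ℝ} (hχ : ContDiff ℝ ∞ χ) (hχs : HasCompactSupport χ)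
    (hker : ∀ ε > 0, ∃ (c : Plane) (r : ℝ), 0 < r ∧ Metric.closedBall c r ⊆ Metric.ball 0 ε ∧
      ∀ x ∈ Ω, ∀ y ∈ tsupport χ, x - y ∈ Metric.closedBall c r → y ∈ Ω) (u : H1 Ω) :
    ∃ v : H1 Ω, v ∈ closure (range (smoothToH1 ho hb)) ∧
      H1.toL2 v =ᵐ[volume.restrict Ω] fun x => χ x • H1.toL2 u x := by
  have hV : MemLp (fun x => χ x • H1.toL2 u x) 2 (volume.restrict Ω) :=
    memLp_cutoff_smul hχ.continuous hχs (Lp.memLp _)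
  set P : Plane → EuclideanSpace ℂ (Fin 2) :=
    fun x => !₂[cutoffDeriv χ u 0 x, cutoffDeriv χ u 1 x] with hP
  have hPi : ∀ x i, P x i = cutoffDeriv χ u i x := fun x i => by fin_cases i <;> rfl
  have hPm : MemLp P 2 (volume.restrict Ω) := by
    refine MemLp.of_eval_piLp fun i => ?_
    simp only [hPi]
    exact (memLp_cutoffDeriv ho hχ hχs u i).restrict Ω
  set W : WithLp 2 (L2 Ω × L2Vec Ω) := WithLp.toLp 2 (hV.toLp _, hPm.toLp P) with hW
  have hclos : W ∈ closure ((↑) '' range (smoothToH1 ho hb)) := by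
    rw [EMetric.mem_closure_iff]
    intro ε hε
    obtain ⟨η, hη0, hη⟩ : ∃ η : ℝ≥0∞, 0 < η ∧ 3 * η ^ 2 < ε ^ 2 := by
      have h1 : Tendsto (fun η : ℝ≥0∞ => 3 * η ^ 2) (𝓝[>] 0) (𝓝 0) := by
        have : Tendsto (fun η : ℝ≥0∞ => 3 * η ^ 2) (𝓝 0) (𝓝 (3 * 0 ^ 2)) :=
          ENNReal.Tendsto.const_mul (((ENNReal.continuous_pow 2).tendsto 0)) (Or.inr (by simp))
        simpa using this.mono_left nhdsWithin_le_nhds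
      have h2 := h1.eventually_lt_const (u := ε ^ 2) (by positivity)
      obtain ⟨η, h3, h4⟩ := (h2.and self_mem_nhdsWithin).exists
      exact ⟨η, h4, h3⟩
    obtain ⟨δ, hδ, hconv⟩ := exists_lintegral_conv_sub_le (memLp_cutoffFun ho hχ hχs u)
      (measurable_cutoffFun ho hχ u) hη0
    choose δ' hδ' hconv' using fun i => exists_lintegral_conv_sub_le
      (memLp_cutoffDeriv ho hχ hχs u i) (measurable_cutoffDeriv ho hχ u i) hη0
    obtain ⟨c, r, hr, hcr, hin⟩ := hker (min δ (min (δ' 0) (δ' 1)))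
      (lt_min hδ (lt_min (hδ' 0) (hδ' 1)))
    set β : ContDiffBump c := ⟨r / 2, r, by positivity, by linarith⟩ with hβ
    set ρ : Plane → ℝ := β.normed volume with hρ
    have hρd : ContDiff ℝ ∞ ρ := β.contDiff_normed
    have hρs : HasCompactSupport ρ := β.hasCompactSupport_normed
    have hρt : tsupport ρ = Metric.closedBall c r := β.tsupport_normed_eq
    have hρsub : Function.support ρ ⊆ Metric.ball 0 (min δ (min (δ' 0) (δ' 1))) :=
      (subset_tsupport ρ).trans (hρt ▸ hcr)
    have h0 := hconv ρ hρd.continuous hρs β.nonneg_normed β.integral_normed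
      (hρsub.trans (Metric.ball_subset_ball (min_le_left _ _)))
    have hi : ∀ i, ∫⁻ x, ‖conv ρ (cutoffDeriv χ u i) x - cutoffDeriv χ u i x‖ₑ ^ 2 ≤ η ^ 2 := by
      intro i
      refine hconv' i ρ hρd.continuous hρs β.nonneg_normed β.integral_normed
        (hρsub.trans (Metric.ball_subset_ball ((min_le_right _ _).trans ?_)))
      fin_cases i
      · exact min_le_left _ _
      · exact min_le_right _ _
    have hφ : ContDiff ℝ ∞ (conv ρ (cutoffFun χ u)) :=
      contDiff_conv hρd hρs (memLp_cutoffFun ho hχ hχs u)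
    refine ⟨_, mem_image_of_mem _ (mem_range_self ⟨conv ρ (cutoffFun χ u), hφ⟩), ?_⟩
    rw [edist_comm, edist_eq_enorm_sub]
    set w : WithLp 2 (L2 Ω × L2Vec Ω) :=
      (smoothToH1 ho hb ⟨conv ρ (cutoffFun χ u), hφ⟩).1 with hw
    have hfst : ‖(w - W).fst‖ₑ ^ 2 ≤ η ^ 2 := by
      refine le_trans (le_of_eq ?_) ((setLIntegral_le_lintegral Ω _).trans h0)
      rw [WithLp.sub_fst, Lp.enorm_def, eLpNorm_two_sq]
      refine lintegral_congr_ae ?_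
      filter_upwards [Lp.coeFn_sub w.fst W.fst, hV.coeFn_toLp,
        coeFn_smoothToH1 ho hb ⟨conv ρ (cutoffFun χ u), hφ⟩,
        ae_restrict_mem ho.measurableSet] with x h1 h2 h3 h4
      have h3' : w.fst x = conv ρ (cutoffFun χ u) x := h3
      have h2' : W.fst x = cutoffFun χ u x := by
        rw [cutoffFun, indicator_of_mem h4]; exact h2
      rw [h1, Pi.sub_apply, h2', h3']
    have hsnd : ‖(w - W).snd‖ₑ ^ 2 ≤ 2 * η ^ 2 := by
      rw [WithLp.sub_snd, Lp.enorm_def, eLpNorm_two_sq,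
        lintegral_enorm_sq_euclidean (Lp.aestronglyMeasurable _), Fin.sum_univ_two, two_mul]
      have key : ∀ i, ∫⁻ x in Ω, ‖(w.snd - W.snd) x i‖ₑ ^ 2 ≤ η ^ 2 := by
        intro i
        refine le_trans (le_of_eq ?_) ((setLIntegral_le_lintegral Ω _).trans (hi i))
        refine lintegral_congr_ae ?_
        filter_upwards [Lp.coeFn_sub w.snd W.snd, hPm.coeFn_toLp,
          (memLp_of_isBounded hb (continuous_gradient hφ)).coeFn_toLp,
          ae_restrict_mem ho.measurableSet] with x h1 h2 h3 h4
        have h3' : w.snd x = gradient (conv ρ (cutoffFun χ u)) x := h3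
        have h2' : W.snd x = P x := h2
        rw [h1, Pi.sub_apply, PiLp.sub_apply, h2', h3', gradient_apply, hPi,
          fderiv_conv_cutoffFun ho hχ hχs hρd hρs u i
            fun y hy hxy => hin x h4 y hy (hρt ▸ hxy)]
      exact add_le_add (key 0) (key 1)
    have hlt : ‖w - W‖ₑ ^ 2 < ε ^ 2 := by
      rw [enorm_sq_withLp]
      refine (add_le_add hfst hsnd).trans_lt (lt_of_eq_of_lt ?_ hη)
      ring
    exact lt_of_pow_lt_pow_left' 2 hlt
  have hWmem : W ∈ H1 Ω := by
    refine (isClosed_H1 Ω).closure_subset_iff.2 ?_ hclos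
    rintro _ ⟨v, -, rfl⟩
    exact v.2
  refine ⟨⟨W, hWmem⟩, ?_, hV.coeFn_toLp⟩
  rw [Topology.IsInducing.subtypeVal.closure_eq_preimage_closure_image]
  exact hclos

/-- Smooth functions are dense in `H¹(Ω)` for a bounded Lipschitz domain: with a partition of
unity, only functions supported near one boundary point or away from the boundary matter; near a
boundary point the kernels are shifted in the downward direction of the local graph. -/
theorem denseRange_smoothToH1 {Ω : Set Plane} (ho : IsOpen Ω) (hb : Bornology.IsBounded Ω)
    (hL : HasLipschitzBoundary Ω) : DenseRange (smoothToH1 ho hb) := by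
  -- local form: every point of the closure has a neighbourhood of good cutoffs
  have hloc : ∀ x₀ ∈ closure Ω, ∃ V : Set Plane, IsOpen V ∧ x₀ ∈ V ∧ Bornology.IsBounded V ∧
      ∀ χ : Plane → ℝ, HasCompactSupport χ → tsupport χ ⊆ V →
        ∀ ε > 0, ∃ (c : Plane) (r : ℝ), 0 < r ∧ Metric.closedBall c r ⊆ Metric.ball 0 ε ∧
          ∀ x ∈ Ω, ∀ y ∈ tsupport χ, x - y ∈ Metric.closedBall c r → y ∈ Ω := by
    intro x₀ hx₀
    by_cases hx₀Ω : x₀ ∈ Ω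
    · refine ⟨Ω, ho, hx₀Ω, hb, fun χ _ hχ ε hε => ⟨0, ε / 2, by positivity, ?_, ?_⟩⟩
      · exact Metric.closedBall_subset_ball (by linarith)
      · exact fun x _ y hy _ => hχ hy
    · obtain ⟨R, γ, K, r, hr, hγ, hΩ⟩ := hL x₀ (ho.frontier_eq ▸ ⟨hx₀, hx₀Ω⟩)
      have hK : (0 : ℝ) ≤ K := K.2
      refine ⟨Metric.ball x₀ (r / 2), Metric.isOpen_ball, Metric.mem_ball_self (by positivity),
        Metric.isBounded_ball, fun χ _ hχ ε hε => ?_⟩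
      set t : ℝ := min ε r / 4 with ht
      have htε : 4 * t ≤ ε := by rw [ht]; linarith [min_le_left ε r]
      have htr : 4 * t ≤ r := by rw [ht]; linarith [min_le_right ε r]
      have ht0 : 0 < t := by positivity
      -- with this `d`, the closed ball of radius `d` about the point `t` below the origin lies in
      -- the downward cone of slope `K`
      set d : ℝ := t / (2 * (1 + K)) with hd
      have hd0 : 0 < d := by positivity
      have hdt : 2 * (d + K * d) = t := by rw [hd]; field_simp
      have hKd : 0 ≤ K * d := by positivity
      have hc : ‖chart R (0, -t)‖ ≤ t := by
        simpa [abs_of_pos ht0] using norm_chart_le R (0, -t)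
      have hz : ∀ z ∈ Metric.closedBall (chart R (0, -t)) d, ‖z‖ ≤ 2 * t := by
        intro z hz
        rw [mem_closedBall_iff_norm] at hz
        have := norm_le_norm_add_norm_sub' z (chart R (0, -t))
        linarith
      refine ⟨chart R (0, -t), d, hd0, fun z hzc => ?_, fun x hx y hy hxy => ?_⟩
      · rw [mem_ball_zero_iff]
        have := hz z hzc
        linarith
      · have hyb : dist y x₀ < r / 2 := hχ hy
        have hyr : y ∈ Metric.ball x₀ r := Metric.mem_ball.2 (by linarith)
        have hxr : x ∈ Metric.ball x₀ r := by
          rw [Metric.mem_ball]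
          have h1 := dist_triangle x y x₀
          have h2 := hz _ hxy
          rw [← dist_eq_norm] at h2
          linarith
        have h1 := (hΩ x hxr).1 hx
        rw [hΩ y hyr]
        rw [mem_closedBall_iff_norm] at hxy
        have hco : ∀ i : Fin 2, |R x i - R y i - R (chart R (0, -t)) i| ≤ d := fun i => by
          have h2 := PiLp.norm_apply_le (R (x - y - chart R (0, -t))) i
          rw [R.norm_map, map_sub, map_sub, PiLp.sub_apply, PiLp.sub_apply,
            Real.norm_eq_abs] at h2
          exact h2.trans hxy
        have h20 := hco 0
        have h21 := hco 1
        rw [apply_chart_zero, sub_zero] at h20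
        rw [apply_chart_one] at h21
        have h3 := hγ.dist_le_mul (R x 0) (R y 0)
        rw [Real.dist_eq, Real.dist_eq] at h3
        have h4 : K * |R x 0 - R y 0| ≤ K * d := mul_le_mul_of_nonneg_left h20 hK
        have h5 := abs_le.1 (h3.trans h4)
        have h6 := abs_le.1 h21
        simp only at h6
        linarith [h5.1, h6.2]
  choose! V hVo hxV hVb hVker using hloc
  have hcl : IsCompact (closure Ω) := hb.isCompact_closure
  obtain ⟨T, hT, hcov⟩ := hcl.elim_nhds_subcover V fun x hx => (hVo x hx).mem_nhds (hxV x hx)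
  obtain ⟨f, hf⟩ := SmoothPartitionOfUnity.exists_isSubordinate (ι := T)
    (modelWithCornersSelf ℝ Plane) isClosed_closure (fun i => V i)
    (fun i => hVo i (hT i i.2)) (by rwa [iUnion_subtype (· ∈ T) fun i => V i])
  have hfd : ∀ i, ContDiff ℝ ∞ (f i) := fun i => (f i).contMDiff.contDiff
  have hfs : ∀ i, HasCompactSupport (f i) := fun i =>
    ((hVb i (hT i i.2)).subset (hf i)).isCompact_closure.of_isClosed_subset
      (isClosed_tsupport _) subset_closure
  intro u
  choose v hv hvu using fun i : T => exists_cutoff_mem_closure ho hb (hfd i) (hfs i)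
    (hVker i (hT i i.2) (f i) (hfs i) (hf i)) u
  have hsum : ∑ i, v i = u := by
    refine H1.ext_toL2 ho (Lp.ext ?_)
    have h1 : H1.toL2 (∑ i, v i) = ∑ i, H1.toL2 (v i) := map_sum (inclL2 Ω) _ _
    rw [h1]
    have h2 : ∀ᵐ x ∂(volume.restrict Ω), ∀ i, H1.toL2 (v i) x = f i x • H1.toL2 u x :=
      ae_all_iff.2 hvu
    filter_upwards [Lp.coeFn_finsetSum Finset.univ fun i => H1.toL2 (v i), h2,
      ae_restrict_mem ho.measurableSet] with x hx1 hx2 hx3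
    rw [hx1, Finset.sum_apply]
    simp only [hx2]
    rw [← Finset.sum_smul, ← finsum_eq_sum_of_fintype, f.sum_eq_one (subset_closure hx3), one_smul]
  rw [← hsum]
  have hcs : ∀ w : H1 Ω, w ∈ closure (range (smoothToH1 ho hb)) ↔
      w ∈ (LinearMap.range (smoothToH1 ho hb)).topologicalClosure := fun w => Iff.rfl
  rw [hcs]
  exact Submodule.sum_mem _ fun i _ => (hcs _).1 (hv i)

/-! ### Rellich's theorem -/

/-- An operator on a Hilbert space is compact if for every `ε > 0` its norm is at most `ε` on a
closed subspace of finite codimension. -/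
theorem isCompactOperator_of_finite_functionals {H F : Type*} [NormedAddCommGroup H]
    [InnerProductSpace ℂ H] [CompleteSpace H] [NormedAddCommGroup F] [NormedSpace ℂ F]
    [CompleteSpace F] (j : H →L[ℂ] F)
    (h : ∀ ε > 0, ∃ (n : Type) (_ : Fintype n) (ℓ : H →L[ℂ] (n → ℂ)),
      ∀ u, ℓ u = 0 → ‖j u‖ ≤ ε * ‖u‖) : IsCompactOperator j := by
  refine isClosed_setOfPred_isCompactOperator.closure_subset (Metric.mem_closure_iff.2 ?_)
  intro ε hε
  obtain ⟨n, _, ℓ, hℓ⟩ := h (ε / 2) (by positivity)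
  set N : Submodule ℂ H := LinearMap.ker ℓ.toLinearMap with hN
  have hNc : IsClosed (N : Set H) := ℓ.isClosed_ker
  have : CompleteSpace N := hNc.completeSpace_coe
  -- the orthogonal complement of the common kernel is finite dimensional
  have hfin : FiniteDimensional ℂ Nᗮ := by
    refine FiniteDimensional.of_injective (ℓ.toLinearMap.comp Nᗮ.subtype) ?_
    rw [← LinearMap.ker_eq_bot, LinearMap.ker_eq_bot']
    intro x hx
    have h1 : (x : H) ∈ N := hx
    exact Subtype.ext (inner_self_eq_zero.1 (x.2 x h1))
  have hcomp : IsCompactOperator (j.comp Nᗮ.starProjection) := by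
    have h1 : IsCompactOperator (id : Nᗮ → Nᗮ) :=
      (isCompactOperator_id_iff_finiteDimensional (𝕜 := ℂ)).2 hfin
    exact (h1.comp_clm Nᗮ.orthogonalProjectionOnto).clm_comp (j.comp Nᗮ.subtypeL)
  refine ⟨j.comp Nᗮ.starProjection, hcomp, ?_⟩
  rw [dist_eq_norm]
  refine lt_of_le_of_lt ?_ (half_lt_self hε)
  refine ContinuousLinearMap.opNorm_le_bound _ (by positivity) fun u => ?_
  have h2 : (j - j.comp Nᗮ.starProjection) u = j (N.starProjection u) := by
    rw [Submodule.starProjection_orthogonal']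
    simp
  rw [h2]
  refine (hℓ _ (N.starProjection_apply_mem u)).trans ?_
  gcongr
  exact N.norm_starProjection_apply_le u

theorem continuous_enorm_sq {X E : Type*} [TopologicalSpace X] [NormedAddCommGroup E] {f : X → E}
    (hf : Continuous f) : Continuous fun x => ‖f x‖ₑ ^ 2 :=
  (ENNReal.continuous_pow 2).comp hf.enorm

/-- Integration over a measurable set `S`, as a continuous functional on `H¹(Ω)`. -/
def integralOn {Ω : Set Plane} (hb : Bornology.IsBounded Ω) {S : Set Plane}
    (hS : MeasurableSet S) : H1 Ω →L[ℂ] ℂ :=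
  have := isFiniteMeasure_restrict_of_isBounded hb
  (innerSL ℂ (indicatorConstLp 2 hS (measure_ne_top (volume.restrict Ω) S) (1 : ℂ))).comp
    (inclL2 Ω)

theorem integralOn_smoothToH1 {Ω : Set Plane} (ho : IsOpen Ω) (hb : Bornology.IsBounded Ω)
    {S : Set Plane} (hS : MeasurableSet S) (hSΩ : S ⊆ Ω) (φ : smoothFun) :
    integralOn hb hS (smoothToH1 ho hb φ) = ∫ x in S, φ.1 x := by
  have h1 : integralOn hb hS (smoothToH1 ho hb φ) =
      ∫ x in S, H1.toL2 (smoothToH1 ho hb φ) x ∂(volume.restrict Ω) :=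
    L2.inner_indicatorConstLp_one hS _ _
  rw [h1, Measure.restrict_restrict hS, inter_eq_left.2 hSΩ]
  refine integral_congr_ae ?_
  exact ae_restrict_of_ae_restrict_of_subset hSΩ (coeFn_smoothToH1 ho hb φ)

/-- Rellich's theorem: the inclusion of `H¹(Ω)` into `L²(Ω)` is compact. -/
theorem isCompactOperator_inclL2 {Ω : Set Plane} (ho : IsOpen Ω) (hb : Bornology.IsBounded Ω)
    (hL : HasLipschitzBoundary Ω) : IsCompactOperator (inclL2 Ω) := by
  refine isCompactOperator_of_finite_functionals _ fun ε hε => ?_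
  obtain ⟨h, T, C, hC, hT, hest⟩ := exists_finite_averages_bound ho hb hL (pow_pos hε 2)
  set ℓ : T → H1 Ω →L[ℂ] ℂ := fun p => integralOn hb (measurableSet_square p.1.1 p.1.2 h) with hℓ
  refine ⟨T, inferInstance, ContinuousLinearMap.pi ℓ, fun u hu => ?_⟩
  have hall : ∀ v : H1 Ω, ‖inclL2 Ω v‖ₑ ^ 2 ≤
      ENNReal.ofReal (ε ^ 2) * ‖v‖ₑ ^ 2 + C * ∑ p, ‖ℓ p v‖ₑ ^ 2 := by
    intro v
    refine (denseRange_smoothToH1 ho hb hL).induction_on (p := fun v : H1 Ω => ‖inclL2 Ω v‖ₑ ^ 2 ≤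
      ENNReal.ofReal (ε ^ 2) * ‖v‖ₑ ^ 2 + C * ∑ p, ‖ℓ p v‖ₑ ^ 2) v (isClosed_le ?_ ?_) fun φ => ?_
    · exact continuous_enorm_sq (inclL2 Ω).continuous
    · have h1 : Continuous fun v : H1 Ω => ENNReal.ofReal (ε ^ 2) * ‖v‖ₑ ^ 2 :=
        (ENNReal.continuous_const_mul ENNReal.ofReal_ne_top).comp
          (continuous_enorm_sq continuous_id)
      have h2 : Continuous fun v : H1 Ω => ∑ p, ‖ℓ p v‖ₑ ^ 2 :=
        continuous_finsetSum _ fun p _ => continuous_enorm_sq (ℓ p).continuous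
      exact h1.add ((ENNReal.continuous_const_mul hC).comp h2)
    · have h1 : ‖inclL2 Ω (smoothToH1 ho hb φ)‖ₑ ^ 2 = ∫⁻ x in Ω, ‖φ.1 x‖ₑ ^ 2 := by
        rw [Lp.enorm_def, eLpNorm_two_sq]
        refine lintegral_congr_ae ?_
        filter_upwards [coeFn_smoothToH1 ho hb φ] with x hx
        rw [← hx]
        rfl
      have h2 : ∑ p ∈ T, ‖∫ x in square p.1 p.2 h, φ.1 x‖ₑ ^ 2 =
          ∑ p, ‖ℓ p (smoothToH1 ho hb φ)‖ₑ ^ 2 := by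
        rw [← Finset.sum_coe_sort]
        refine Finset.sum_congr rfl fun p _ => ?_
        rw [hℓ, integralOn_smoothToH1 ho hb _ (hT p p.2)]
      rw [h1, ← h2]
      refine (hest φ.1 (contDiff_smoothFun φ)).trans ?_
      gcongr
      exact lintegral_energyDensity_le ho hb φ
  have hu' : ∀ p, ℓ p u = 0 := fun p => congrFun hu p
  have h3 := hall u
  simp only [hu', enorm_zero, ne_eq, OfNat.ofNat_ne_zero, not_false_eq_true, zero_pow,
    Finset.sum_const_zero, mul_zero, add_zero] at h3
  rw [ENNReal.ofReal_pow hε.le, ← mul_pow] at h3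
  have h4 : ‖inclL2 Ω u‖ₑ ≤ ENNReal.ofReal ε * ‖u‖ₑ := (ENNReal.pow_le_pow_left_iff two_ne_zero).1 h3
  have h5 := ENNReal.toReal_mono (by finiteness) h4
  rwa [toReal_enorm, ENNReal.toReal_mul, toReal_enorm, ENNReal.toReal_ofReal hε.le] at h5

/-! ### The trace operator -/

theorem memLp_boundaryMeasure {Ω : Set Plane} (ho : IsOpen Ω) (hb : Bornology.IsBounded Ω)
    (hL : HasLipschitzBoundary Ω) {φ : Plane → ℂ} (hφ : ContDiff ℝ ∞ φ) :
    MemLp φ 2 (boundaryMeasure Ω) := by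
  obtain ⟨δ₀, -, C, hC, h⟩ := exists_boundary_estimates ho hb hL
  refine ⟨hφ.continuous.aestronglyMeasurable, ?_⟩
  have h1 : eLpNorm φ 2 (boundaryMeasure Ω) ^ 2 < ⊤ := by
    rw [eLpNorm_two_sq]
    refine ((h φ hφ).1.trans (mul_le_mul_right
      (lintegral_energyDensity_le ho hb ⟨φ, hφ⟩) C)).trans_lt ?_
    exact ENNReal.mul_lt_top hC.lt_top (by finiteness)
  exact (ENNReal.pow_lt_top_iff.1 h1).resolve_right two_ne_zero

/-- Restriction of smooth functions to the boundary. -/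
def smoothToBdry {Ω : Set Plane} (ho : IsOpen Ω) (hb : Bornology.IsBounded Ω)
    (hL : HasLipschitzBoundary Ω) : smoothFun →ₗ[ℂ] L2Bdry Ω where
  toFun φ := (memLp_boundaryMeasure ho hb hL (contDiff_smoothFun φ)).toLp φ.1
  map_add' _ _ := rfl
  map_smul' _ _ := rfl

/-- The trace inequality. -/
theorem exists_norm_smoothToBdry_le {Ω : Set Plane} (ho : IsOpen Ω) (hb : Bornology.IsBounded Ω)
    (hL : HasLipschitzBoundary Ω) :
    ∃ C : ℝ, ∀ φ, ‖smoothToBdry ho hb hL φ‖ ≤ C * ‖smoothToH1 ho hb φ‖ := by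
  obtain ⟨δ₀, -, C, hC, h⟩ := exists_boundary_estimates ho hb hL
  refine ⟨√C.toReal, fun φ => ?_⟩
  have h1 : ‖smoothToBdry ho hb hL φ‖ₑ ^ 2 ≤ C * ‖smoothToH1 ho hb φ‖ₑ ^ 2 := by
    have h2 : ‖smoothToBdry ho hb hL φ‖ₑ = eLpNorm φ.1 2 (boundaryMeasure Ω) :=
      Lp.enorm_toLp (memLp_boundaryMeasure ho hb hL (contDiff_smoothFun φ))
    rw [h2, eLpNorm_two_sq]
    exact (h φ.1 (contDiff_smoothFun φ)).1.trans
      (mul_le_mul_right (lintegral_energyDensity_le ho hb φ) C)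
  have h3 := ENNReal.toReal_mono (by finiteness) h1
  rw [ENNReal.toReal_pow, ENNReal.toReal_mul, ENNReal.toReal_pow, toReal_enorm, toReal_enorm] at h3
  refine le_of_sq_le_sq ?_ (by positivity)
  rwa [mul_pow, Real.sq_sqrt ENNReal.toReal_nonneg]

/-- The trace operator `H¹(Ω) → L²(∂Ω)`. -/
def traceOp {Ω : Set Plane} (ho : IsOpen Ω) (hb : Bornology.IsBounded Ω)
    (hL : HasLipschitzBoundary Ω) : H1 Ω →L[ℂ] L2Bdry Ω :=
  (smoothToBdry ho hb hL).extendOfNorm (smoothToH1 ho hb)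

theorem traceOp_smoothToH1 {Ω : Set Plane} (ho : IsOpen Ω) (hb : Bornology.IsBounded Ω)
    (hL : HasLipschitzBoundary Ω) (φ : smoothFun) :
    traceOp ho hb hL (smoothToH1 ho hb φ) = smoothToBdry ho hb hL φ :=
  LinearMap.extendOfNorm_eq (denseRange_smoothToH1 ho hb hL)
    (exists_norm_smoothToBdry_le ho hb hL) φ

/-- The traces in the sense of limits of smooth functions are the values of the trace operator. -/
theorem isTrace_iff {Ω : Set Plane} (ho : IsOpen Ω) (hb : Bornology.IsBounded Ω)
    (hL : HasLipschitzBoundary Ω) (v : H1 Ω) (τ : L2Bdry Ω) :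
    IsTrace Ω v τ ↔ τ = traceOp ho hb hL v := by
  constructor
  · rintro ⟨φ, w, t, hφ, hw, ht, hwv, htτ⟩
    have hwφ : ∀ m, w m = smoothToH1 ho hb ⟨φ m, hφ m⟩ := fun m =>
      H1.ext_toL2 ho (Lp.ext ((hw m).trans (coeFn_smoothToH1 ho hb ⟨φ m, hφ m⟩).symm))
    have htφ : ∀ m, t m = traceOp ho hb hL (w m) := fun m => by
      rw [hwφ, traceOp_smoothToH1]
      exact Lp.ext ((ht m).trans (memLp_boundaryMeasure ho hb hL (hφ m)).coeFn_toLp.symm)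
    refine tendsto_nhds_unique htτ ?_
    simp only [funext htφ]
    exact ((traceOp ho hb hL).continuous.tendsto v).comp hwv
  · rintro rfl
    obtain ⟨w, hw, hwv⟩ := mem_closure_iff_seq_limit.1 (denseRange_smoothToH1 ho hb hL v)
    choose φ hφ using hw
    refine ⟨fun m => (φ m).1, w, fun m => traceOp ho hb hL (w m),
      fun m => contDiff_smoothFun (φ m), fun m => ?_, fun m => ?_, hwv,
      ((traceOp ho hb hL).continuous.tendsto v).comp hwv⟩
    · rw [← hφ m]
      exact coeFn_smoothToH1 ho hb (φ m)
    · change traceOp ho hb hL (w m) =ᵐ[boundaryMeasure Ω] (φ m).1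
      rw [← hφ m, traceOp_smoothToH1]
      exact (memLp_boundaryMeasure ho hb hL (contDiff_smoothFun (φ m))).coeFn_toLp

/-! ### The variational problem -/

/-- Multiplication by a bounded function on `L²(Ω)`. -/
def mulL2 {Ω : Set Plane} {m : Plane → ℂ} (hm : MemLp m ⊤ (volume.restrict Ω)) :
    L2 Ω →L[ℂ] L2 Ω :=
  (ContinuousLinearMap.mul ℂ ℂ).holderL (volume.restrict Ω) ⊤ 2 2 (hm.toLp m)

theorem coeFn_mulL2 {Ω : Set Plane} {m : Plane → ℂ} (hm : MemLp m ⊤ (volume.restrict Ω))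
    (u : L2 Ω) : mulL2 hm u =ᵐ[volume.restrict Ω] fun x => m x * u x := by
  have h : mulL2 hm u =ᵐ[volume.restrict Ω] fun x => hm.toLp m x * u x :=
    (ContinuousLinearMap.mul ℂ ℂ).coeFn_holder (r := 2) (hm.toLp m) u
  filter_upwards [h, hm.coeFn_toLp] with x h1 h2
  rw [h1, h2]

/-- The compact operator `K` on `H¹(Ω)` with `a(u, v) = ⟪v, u - K u⟫`. -/
def perturbation {Ω : Set Plane} {m : Plane → ℂ} (hm : MemLp m ⊤ (volume.restrict Ω)) :
    H1 Ω →L[ℂ] H1 Ω :=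
  (ContinuousLinearMap.adjoint (inclL2 Ω)).comp ((1 + mulL2 hm).comp (inclL2 Ω))

theorem form_eq_inner {Ω : Set Plane} {κ : ℂ} {n : Plane → ℂ}
    (hm : MemLp (fun x => κ * n x) ⊤ (volume.restrict Ω)) (u v : H1 Ω) :
    form κ n u v = ⟪v, u - perturbation hm u⟫_ℂ := by
  have h1 : ⟪v, u⟫_ℂ = ⟪H1.toL2 v, H1.toL2 u⟫_ℂ + ⟪H1.grad v, H1.grad u⟫_ℂ :=
    WithLp.prod_inner_apply (v : WithLp 2 (L2 Ω × L2Vec Ω)) u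
  have h2 : ⟪v, perturbation hm u⟫_ℂ =
      ⟪H1.toL2 v, H1.toL2 u⟫_ℂ + ⟪H1.toL2 v, mulL2 hm (H1.toL2 u)⟫_ℂ := by
    rw [perturbation, ContinuousLinearMap.comp_apply, ContinuousLinearMap.adjoint_inner_right,
      ← inner_add_right]
    rfl
  have h3 : ⟪H1.grad v, H1.grad u⟫_ℂ = ∫ x in Ω, ∑ i, H1.grad u x i * conj (H1.grad v x i) := by
    rw [L2.inner_def]
    refine integral_congr_ae (.of_forall fun x => ?_)
    simp only [PiLp.inner_apply, RCLike.inner_apply]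
  have h4 : ⟪H1.toL2 v, mulL2 hm (H1.toL2 u)⟫_ℂ =
      κ * ∫ x in Ω, n x * H1.toL2 u x * conj (H1.toL2 v x) := by
    rw [L2.inner_def, ← integral_const_mul]
    refine integral_congr_ae ?_
    filter_upwards [coeFn_mulL2 hm (H1.toL2 u)] with x hx
    rw [hx, RCLike.inner_apply]
    ring
  rw [inner_sub_right, h1, h2, h3, h4, form]
  ring

theorem bdryPairing_eq_inner {Ω : Set Plane} (f g : L2Bdry Ω) : bdryPairing f g = ⟪g, f⟫_ℂ := by
  rw [L2.inner_def]
  rfl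

/-- Fredholm alternative: if `κ` is not a Neumann eigenvalue, then `1 - K` is invertible. -/
theorem isUnit_one_sub_perturbation {Ω : Set Plane} (ho : IsOpen Ω) (hb : Bornology.IsBounded Ω)
    (hL : HasLipschitzBoundary Ω) {κ : ℂ} {n : Plane → ℂ}
    (hm : MemLp (fun x => κ * n x) ⊤ (volume.restrict Ω)) (hκ : ¬ IsNeumannEigenvalue Ω n κ) :
    IsUnit (1 - perturbation hm) := by
  have hK : IsCompactOperator (perturbation hm) := by
    have h1 := (isCompactOperator_inclL2 ho hb hL).clm_comp (1 + mulL2 hm)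
    rw [← ContinuousLinearMap.coe_comp] at h1
    have h2 := h1.clm_comp (ContinuousLinearMap.adjoint (inclL2 Ω))
    rw [← ContinuousLinearMap.coe_comp] at h2
    exact h2
  rcases hK.hasEigenvalue_or_mem_resolventSet one_ne_zero with h | h
  · obtain ⟨u, hu⟩ := h.exists_hasEigenvector
    refine absurd ⟨u, hu.2, fun v => ?_⟩ hκ
    have h1 : perturbation hm u = u := by simpa using hu.apply_eq_smul
    rw [form_eq_inner hm, h1, sub_self, inner_zero_right]
  · simpa [resolventSet] using h

theorem solvesSource_iff {Ω : Set Plane} (ho : IsOpen Ω) (hb : Bornology.IsBounded Ω)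
    (hL : HasLipschitzBoundary Ω) {k : ℝ} {n : Plane → ℂ}
    (hm : MemLp (fun x => (k : ℂ) ^ 2 * n x) ⊤ (volume.restrict Ω)) (g : L2Bdry Ω) (u : H1 Ω) :
    SolvesSource k n g u ↔ (1 - perturbation hm) u =
      ContinuousLinearMap.adjoint (traceOp ho hb hL) g := by
  have h : SolvesSource k n g u ↔ ∀ v : H1 Ω, ⟪v, (1 - perturbation hm) u⟫_ℂ =
      ⟪v, ContinuousLinearMap.adjoint (traceOp ho hb hL) g⟫_ℂ := by
    refine forall_congr' fun v => ?_
    simp only [isTrace_iff ho hb hL, exists_eq, true_and, forall_eq, bdryPairing_eq_inner,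
      form_eq_inner hm, ContinuousLinearMap.adjoint_inner_right]
    rfl
  rw [h]
  exact ⟨fun h => ext_inner_left ℂ h, fun h v => by rw [h]⟩

theorem memLp_top_refractiveIndex {Ω : Set Plane} (ho : IsOpen Ω) (k : ℝ) {n₁ n₂ : Plane → ℝ}
    (h₁ : ContinuousOn n₁ Ω) (h₂ : ContinuousOn n₂ Ω) (hb₁ : ∃ B : ℝ, ∀ x ∈ Ω, |n₁ x| ≤ B)
    (hb₂ : ∃ B : ℝ, ∀ x ∈ Ω, |n₂ x| ≤ B) (κ : ℂ) :
    MemLp (fun x => κ * refractiveIndex k n₁ n₂ x) ⊤ (volume.restrict Ω) := by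
  obtain ⟨B₁, hB₁⟩ := hb₁
  obtain ⟨B₂, hB₂⟩ := hb₂
  have hc : ContinuousOn (fun x => κ * refractiveIndex k n₁ n₂ x) Ω := by
    unfold refractiveIndex
    fun_prop
  refine memLp_top_of_bound (hc.aestronglyMeasurable ho.measurableSet)
    (‖κ‖ * (B₁ + B₂ / |k|)) ?_
  filter_upwards [ae_restrict_mem ho.measurableSet] with x hx
  rw [norm_mul, refractiveIndex]
  gcongr
  refine (norm_add_le _ _).trans (add_le_add ?_ ?_)
  · simpa using hB₁ x hx
  · rw [norm_mul, Complex.norm_I, one_mul, norm_div, Complex.norm_real, Complex.norm_real]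
    simp only [Real.norm_eq_abs]
    gcongr
    exact hB₂ x hx

end Steklov

end

theorem mainTheorem5 (Ω : Set Steklov.Plane) (hΩ : Steklov.IsLipschitzPolygon Ω)
    (k : ℝ) (hk : 0 < k) (n₁ n₂ : Steklov.Plane → ℝ)
    (hn₁_smooth : ContDiffOn ℝ ∞ n₁ Ω) (hn₂_smooth : ContDiffOn ℝ ∞ n₂ Ω)
    (hn₁_bdd : ∃ B : ℝ, ∀ x ∈ Ω, |n₁ x| ≤ B) (hn₂_bdd : ∃ B : ℝ, ∀ x ∈ Ω, |n₂ x| ≤ B)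
    (hn₁_pos : ∀ x ∈ Ω, 0 < n₁ x) (hn₂_nonneg : ∀ x ∈ Ω, 0 ≤ n₂ x)
    (hNeumann : ¬ Steklov.IsNeumannEigenvalue Ω (Steklov.refractiveIndex k n₁ n₂) ((k : ℂ) ^ 2)) :
    ∃ C : ℝ, 0 < C ∧ ∀ g : Steklov.L2Bdry Ω,
      (∃! u : Steklov.H1 Ω,
        Steklov.SolvesSource k (Steklov.refractiveIndex k n₁ n₂) g u) ∧
      ∀ u : Steklov.H1 Ω,
        Steklov.SolvesSource k (Steklov.refractiveIndex k n₁ n₂) g u → ‖u‖ ≤ C * ‖g‖ := by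
  have ho := hΩ.isOpen
  have hb := hΩ.isBounded
  have hL := hΩ.lipschitz
  have hm := Steklov.memLp_top_refractiveIndex ho k hn₁_smooth.continuousOn
    hn₂_smooth.continuousOn hn₁_bdd hn₂_bdd ((k : ℂ) ^ 2)
  obtain ⟨A, hA⟩ := Steklov.isUnit_one_sub_perturbation ho hb hL hm hNeumann
  -- the solution operator `(1 - K)⁻¹ T*`, where `T` is the trace operator
  set S : Steklov.L2Bdry Ω →L[ℂ] Steklov.H1 Ω :=
    (↑A⁻¹ : Steklov.H1 Ω →L[ℂ] Steklov.H1 Ω).comp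
      (ContinuousLinearMap.adjoint (Steklov.traceOp ho hb hL)) with hS
  have hiff : ∀ g u, Steklov.SolvesSource k (Steklov.refractiveIndex k n₁ n₂) g u ↔ u = S g := by
    intro g u
    rw [Steklov.solvesSource_iff ho hb hL hm, ← hA]
    have h1 : ∀ v, (↑A⁻¹ : Steklov.H1 Ω →L[ℂ] Steklov.H1 Ω) (A.1 v) = v := fun v => by
      rw [← mul_apply_eq_comp, A.inv_mul, one_apply_eq_self]
    have h2 : ∀ v, A.1 ((↑A⁻¹ : Steklov.H1 Ω →L[ℂ] Steklov.H1 Ω) v) = v := fun v => by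
      rw [← mul_apply_eq_comp, A.mul_inv, one_apply_eq_self]
    constructor
    · intro h
      rw [hS, ContinuousLinearMap.comp_apply, ← h, h1]
    · rintro rfl
      exact h2 _
  refine ⟨‖S‖ + 1, by positivity, fun g => ⟨⟨S g, (hiff g _).2 rfl, fun u hu => (hiff g u).1 hu⟩,
    fun u hu => ?_⟩⟩
  rw [(hiff g u).1 hu]
  exact (S.le_opNorm g).trans (by gcongr; linarith)
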